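/- Let $\mathcal A$ (actions) and $\mathcal E$ (percepts) be finite alphabets and $n\in\mathbb N$. **Machines and oracles.** A pTM is a Turing machine with input, output and work tapes and a tape of fair random bits; an oracle pTM can in addition write a query on an oracle tape and receive an answer in $\{0,1\}$. An oracle is a function $O$ giving for each query $(T,x,p,\alpha)$, where $T$ is (the description of) an oracle pTM, $x\in(\mathcal A\sqcup\mathcal E)^*$, $p\in\mathbb Q\cap[0,1]$ and $\alpha\in\mathcal A$, the probability $O_\alpha(T,x,p)\in[0,1]$ that the query is answered by $1$; answers are drawn independently for each call. Let $\lambda_T^O(\alpha|x)$ be the probability that $T$ with oracle $O$ on input $x$ halts with output exactly the symbol $\alpha$ (and $\lambda_T$ the same for a pTM without oracle). $O$ is *reflective* if for all $T,x$ there are reals $(q_\alpha)_{\alpha\in\mathcal A}$ with $\sum_\alpha q_\alpha=1$ such that for all $\alpha$ and $p$: $\lambda_T^O(\alpha|x)\le q_\alpha\le 1-\sum_{\beta\ne\alpha}\lambda_T^O(\beta|x)$, $O_\alpha(T,x,p)=1$ if $p<q_\alpha$, and $O_\alpha(T,x,p)=0$ if $p>q_\alpha$. **Games.** A strategy is a map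 $\pi:(\mathcal A\times\mathcal E)^*\to\Delta\mathcal A$; the oracle pTM $T$ generates $\pi$ if $\pi(a|h)=\lambda_T^O(a|h)$ for all $h,a$ (then $\pi\in\mathcal P^O_{\rm refl}$). An $n$-player game is a map $\sigma:(\mathcal A^n\times\mathcal E^n)^*\times\mathcal A^n\to\Delta(\mathcal E^n)$; a pTM $T$ without oracle generates $\sigma$ if $\sigma(e|ha)=\lambda_T(e|ha)$ for all $h,a,e$. For strategies $\pi=(\pi_1,\dots,\pi_n)$ the history distribution is $\sigma^\pi(\epsilon)=1$, $\sigma^\pi(ha)=\sigma^\pi(h)\prod_{i=1}^n\pi_i(a^i|h^i)$, $\sigma^\pi(hae)=\sigma^\pi(ha)\,\sigma(e|ha)$, where $h^i$ is player $i$'s part of $h$. Player $i$'s marginal $\sigma_i^\pi(y)$ is the sum of $\sigma^\pi(x)$ over all joint histories $x$ (possibly ending in an action) whose $i$-th part is $y$. Player $i$'s subjective environment is $\sigma_i(e|ha)=\sigma_i^{\pi}(hae)/\sigma_i^{\pi}(ha)$, defined when $\sigma_i^\pi(ha)>0$; its value does not depend on $\pi_i$, so that it is defined as soon as the denominator is positive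 for some choice of player $i$'s strategy. **Estimation.** With access to $O$, an oracle pTM estimates $f:X\to\mathbb R$ on $D\subseteq X$ if on input $(x,k)$, for every $x\in D$ and every integer $k\ge1$, it halts with probability $1$ with a rational output $\varphi$ satisfying $|f(x)-\varphi|<1/k$. **Theorem (subjective environment estimable).** There is an algorithm (one algorithm for all reflective oracles) which, given a pTM $T_\sigma$, oracle pTMs $T_1,\dots,T_n$ and $i\in\{1,\dots,n\}$, constructs oracle pTMs with the following property. Whenever $O$ is a reflective oracle, $T_\sigma$ generates a game $\sigma$, and each $T_j$ with access to $O$ generates a strategy $\pi_j$, the constructed machines with access to $O$ estimate 1. the history distribution: $x\mapsto\sigma^\pi(x)$ on all histories (also those ending in an action), and its conditional probability of the last symbol of a history given the preceding part, wherever that part has positive probability; 2. player $i$'s marginal $y\mapsto\sigma_i^\pi(y)$ on all histories of player $i$ (also those ending in an action), and its conditional probability of the last symbol given the preceding part, wherever that part has positive probability; 3. the subjective environment $(h,a,e)\mapsto\sigma_i(e|ha)$: for every strategy $\rho$ of player $i$ (in particular $\rho=\pi_i$), with $\pi'$ obtained from $\pi$ by replacing $\pi_i$ by $\rho$, the one constructed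 machine estimates $\sigma_i^{\pi'}(hae)/\sigma_i^{\pi'}(ha)$ on all $(h,a,e)$ with $\sigma_i^{\pi'}(ha)>0$. -/

import Mathlib

/-! ## Probabilistic oracle Turing machines -/

/-- Head movements. -/
inductive Move
  | left
  | stay
  | right

/-- What the finite control does in one state.
* `act k rules`: read the symbol `s` under the head of tape `k`; the `s`-th entry `(s', d, q)` of
  `rules` says: write `s'`, move the head by `d`, go to state `q`; without such an entry, halt.
* `flip q₀ q₁`: read the next bit of the random tape and go to `q₀` or `q₁` accordingly.
* `ask q₀ q₁`: submit the query on the oracle tape; go to `q₀` or `q₁` according to the answer. -/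
inductive Instr
  | act (k : ℕ) (rules : List (ℕ × Move × ℕ))
  | flip (q₀ q₁ : ℕ)
  | ask (q₀ q₁ : ℕ)

/-- A (multitape) oracle probabilistic Turing machine. States are the positions in the list, the
initial state is `0`, and a state outside of the list is halting. Tape symbols are numbers, `0` is
the blank; only finitely many symbols and tapes occur in a machine. -/
abbrev OTM := List Instr

def moveEquiv : Move ≃ Option Bool where
  toFun
    | .left => some false
    | .stay => none
    | .right => some true
  invFun
    | some false => .left
    | none => .stay
    | some true => .right
  left_inv m := by cases m <;> rfl
  right_inv m := by rcases m with _ | _ | _ <;> rfl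

instance : Primcodable Move := Primcodable.ofEquiv _ moveEquiv

def instrEquiv : Instr ≃ (ℕ × List (ℕ × Move × ℕ)) ⊕ (ℕ × ℕ) ⊕ (ℕ × ℕ) where
  toFun
    | .act k r => .inl (k, r)
    | .flip a b => .inr (.inl (a, b))
    | .ask a b => .inr (.inr (a, b))
  invFun
    | .inl (k, r) => .act k r
    | .inr (.inl (a, b)) => .flip a b
    | .inr (.inr (a, b)) => .ask a b
  left_inv i := by cases i <;> rfl
  right_inv i := by rcases i with ⟨_, _⟩ | ⟨_, _⟩ | ⟨_, _⟩ <;> rfl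

instance : Primcodable Instr := Primcodable.ofEquiv _ instrEquiv

/-- A plain pTM: an oracle pTM that never consults its oracle. -/
def OTM.OracleFree (M : OTM) : Prop := ∀ q₀ q₁, Instr.ask q₀ q₁ ∉ M

/-- A two-way infinite tape: `left` holds the cells to the left of the head, nearest first, and
`right` the cell under the head and those to its right; all further cells are blank. -/
structure MTape where
  left : List ℕ
  right : List ℕ

namespace MTape

def read (t : MTape) : ℕ := t.right.headD 0

def write (t : MTape) (s : ℕ) : MTape := ⟨t.left, s :: t.right.tail⟩

def move (t : MTape) : Move → MTape
  | .left => ⟨t.left.tail, t.left.headD 0 :: t.right⟩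
  | .stay => t
  | .right => ⟨t.read :: t.left, t.right.tail⟩

/-- The word written on a tape: its nonblank symbols from left to right. -/
def word (t : MTape) : List ℕ := (t.left.reverse ++ t.right).filter (· ≠ 0)

end MTape

/-- A configuration. Tape `0` is the input tape, tape `1` the output tape, tape `2` the oracle
tape, and all others are work tapes. (The random tape is read once, from left to right, so that
each bit read from it is a fresh fair coin flip.) -/
structure Cfg where
  state : ℕ
  tape : ℕ → MTape

def Cfg.init (w : List ℕ) : Cfg := ⟨0, fun k => if k = 0 then ⟨[], w⟩ else ⟨[], []⟩⟩

def Cfg.output (c : Cfg) : List ℕ := (c.tape 1).word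

/-- The symbol on a tape that stands for a letter of an alphabet. -/
def sym {X : Type*} [Encodable X] (x : X) : ℕ := Encodable.encode x + 1

/-- A number is written on a tape as that many strokes. -/
def strokes (m : ℕ) : List ℕ := List.replicate m 1

noncomputable section

/-- One step, where `ans m` is the probability that the oracle answers `1` to the query numbered
`m`: `none` if the machine has halted, and otherwise `some (p, c₁, c₀)`, meaning that the next
configuration is `c₁` with probability `p` and `c₀` with probability `1 - p`. -/
def OTM.step (ans : ℕ → unitInterval) (M : OTM) (c : Cfg) : Option (ℝ × Cfg × Cfg) :=
  match M[c.state]? with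
  | none => none
  | some (.act k rules) =>
    match rules[(c.tape k).read]? with
    | none => none
    | some (s, d, q) =>
      let c' : Cfg := ⟨q, Function.update c.tape k (((c.tape k).write s).move d)⟩
      some (1, c', c')
  | some (.flip q₀ q₁) => some (1 / 2, ⟨q₁, c.tape⟩, ⟨q₀, c.tape⟩)
  | some (.ask q₀ q₁) => some (ans (c.tape 2).word.length, ⟨q₁, c.tape⟩, ⟨q₀, c.tape⟩)

open Classical in
/-- The probability that from configuration `c` the machine halts within `N` steps with an
output word in `S`. -/
def OTM.haltProb (ans : ℕ → unitInterval) (M : OTM) (S : Set (List ℕ)) : ℕ → Cfg → ℝ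
  | 0, c =>
    match M.step ans c with
    | none => if c.output ∈ S then 1 else 0
    | some _ => 0
  | N + 1, c =>
    match M.step ans c with
    | none => if c.output ∈ S then 1 else 0
    | some (p, c₁, c₀) => p * haltProb ans M S N c₁ + (1 - p) * haltProb ans M S N c₀

/-- The probability that on input word `w` the machine halts with an output word in `S`
(the supremum of an increasing sequence bounded by `1`). -/
def OTM.prob (ans : ℕ → unitInterval) (M : OTM) (w : List ℕ) (S : Set (List ℕ)) : ℝ :=
  ⨆ N, M.haltProb ans S N (Cfg.init w)

/-- `λ_M(y | x)`: the probability that on input string `x` the machine outputs the symbol `y`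
and nothing else. -/
def OTM.lam {X : Type*} [Encodable X] (ans : ℕ → unitInterval) (M : OTM) (x : List X) (y : X) :
    ℝ :=
  M.prob ans (x.map sym) {w | w = [sym y]}

/-- `M` estimates `f` on `D`: on input `(x, k)` with `x ∈ D` and `k ≥ 1` it halts with probability
`1` with output a fraction `a / b` such that `|f x - a / b| < 1 / k`. -/
def OTM.Estimates {X : Type*} [Primcodable X] (ans : ℕ → unitInterval) (M : OTM) (f : X → ℝ)
    (D : Set X) : Prop :=
  ∀ x ∈ D, ∀ k : ℕ, 0 < k →
    M.prob ans (strokes (Encodable.encode (x, k)))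
      {w | ∃ a b : ℕ, b ≠ 0 ∧ w = strokes (Encodable.encode (a, b)) ∧
        |f x - (a : ℝ) / b| < 1 / k} = 1

/-! ## Reflective oracles -/

/-- Oracles for action alphabet `A` and string alphabet `A ⊔ E`: `O T x p α` is the probability
that the query `(T, x, p, α)` is answered by `1`. -/
abbrev Oracle (A E : Type*) := OTM → List (A ⊕ E) → Set.Icc (0 : ℚ) 1 → A → unitInterval

/-- The oracle as seen by a machine, which writes the query `(T, x, a / b, α)` as the number of
`(T, x, (a, b), α)`. A number that is not a query is answered by `0`. -/
def Oracle.ans {A E : Type*} [Primcodable A] [Primcodable E] (O : Oracle A E) (m : ℕ) :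
    unitInterval :=
  match Encodable.decode (α := OTM × List (A ⊕ E) × (ℕ × ℕ) × A) m with
  | none => 0
  | some (T, x, (a, b), α) =>
    if h : ((a : ℚ) / b) ∈ Set.Icc (0 : ℚ) 1 then O T x ⟨(a : ℚ) / b, h⟩ α else 0

open Classical in
/-- Reflective oracles. -/
def Oracle.Reflective {A E : Type*} [Fintype A] [Primcodable A] [Primcodable E]
    (O : Oracle A E) : Prop :=
  ∀ (T : OTM) (x : List (A ⊕ E)), ∃ q : A → ℝ, ∑ α, q α = 1 ∧ ∀ α,
    T.lam O.ans x (.inl α) ≤ q α ∧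
    q α ≤ 1 - ∑ β with β ≠ α, T.lam O.ans x (.inl β) ∧
    ∀ p : Set.Icc (0 : ℚ) 1,
      (((p : ℚ) : ℝ) < q α → O T x p α = 1) ∧ (q α < ((p : ℚ) : ℝ) → O T x p α = 0)

/-! ## Strategies and multi-player games -/

/-- The string `a₁ e₁ a₂ e₂ …` of a history. -/
def flat {A E : Type*} (h : List (A × E)) : List (A ⊕ E) :=
  h.flatMap fun p => [.inl p.1, .inr p.2]

/-- A strategy gives for each history a probability distribution on actions. -/
abbrev Strategy (A E : Type*) [Fintype A] := List (A × E) → stdSimplex ℝ A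

/-- A multi-player game: `(𝒜ⁿ × ℰⁿ)* × 𝒜ⁿ → Δ(ℰⁿ)`. -/
abbrev Game (n : ℕ) (A E : Type*) [Fintype E] :=
  List ((Fin n → A) × (Fin n → E)) → (Fin n → A) → stdSimplex ℝ (Fin n → E)

/-- The oracle pTM `T` with access to `O` generates (samples) the strategy `π`. -/
def OTM.GeneratesStrategy {A E : Type*} [Fintype A] [Primcodable A] [Primcodable E]
    (T : OTM) (O : Oracle A E) (π : Strategy A E) : Prop :=
  ∀ h a, π h a = T.lam O.ans (flat h) (.inl a)

/-- The pTM `T` (without oracle) generates (samples) the game `σ`. -/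
def OTM.GeneratesGame {n : ℕ} {A E : Type*} [Fintype E] [Primcodable A] [Primcodable E]
    (T : OTM) (σ : Game n A E) : Prop :=
  T.OracleFree ∧ ∀ h a e, σ h a e = T.lam (fun _ => 0) (flat h ++ [.inl a]) (.inr e)

/-- Histories that may end in an action: `(h, none)` is `æ_{<t}` and `(h, some a)` is
`æ_{<t} a_t`. -/
abbrev Hist (A E : Type*) := List (A × E) × Option A

/-- A history without its last symbol. -/
def Hist.pred {A E : Type*} : Hist A E → Hist A E
  | (h, some _) => (h, none)
  | (h, none) => (h.dropLast, h.getLast?.map Prod.fst)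

/-- The conditional probability under `ν` of the last symbol of a history given the symbols
before it. -/
def condLast {A E : Type*} (ν : Hist A E → ℝ) (y : Hist A E) : ℝ := ν y / ν y.pred

/-- Player `i`'s part of a sequence of joint interactions. -/
def proj {n : ℕ} {A E : Type*} (i : Fin n) (h : List ((Fin n → A) × (Fin n → E))) :
    List (A × E) :=
  h.map fun p => (p.1 i, p.2 i)

section Play

variable {n : ℕ} {A E : Type*} [Fintype A] [Fintype E]

/-- The probability `∏ᵢ πᵢ(aⁱ | æⁱ)` that the players choose the action vector `a` after `h`. -/
def actProb (π : Fin n → Strategy A E) (h : List ((Fin n → A) × (Fin n → E)))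
    (a : Fin n → A) : ℝ :=
  ∏ i, π i (proj i h) (a i)

/-- The history distribution `σ^π`. -/
def histDist (σ : Game n A E) (π : Fin n → Strategy A E) :
    Hist (Fin n → A) (Fin n → E) → ℝ
  | (h, none) =>
    ∏ t : Fin h.length, actProb π (h.take t) h[t].1 * σ (h.take t) h[t].1 h[t].2
  | (h, some a) =>
    (∏ t : Fin h.length, actProb π (h.take t) h[t].1 * σ (h.take t) h[t].1 h[t].2) *
      actProb π h a

theorem histDist_nil (σ : Game n A E) (π : Fin n → Strategy A E) :
    histDist σ π ([], none) = 1 := by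
  simp [histDist]

theorem histDist_action (σ : Game n A E) (π : Fin n → Strategy A E)
    (h : List ((Fin n → A) × (Fin n → E))) (a : Fin n → A) :
    histDist σ π (h, some a) = histDist σ π (h, none) * actProb π h a := rfl

theorem histDist_percept (σ : Game n A E) (π : Fin n → Strategy A E)
    (h : List ((Fin n → A) × (Fin n → E))) (a : Fin n → A) (e : Fin n → E) :
    histDist σ π (h ++ [(a, e)], none) = histDist σ π (h, some a) * σ h a e := by
  simp only [histDist]
  rw [← Fin.prod_congr' _ (show h.length + 1 = (h ++ [(a, e)]).length by simp),
    Fin.prod_univ_castSucc]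
  simp [List.take_append_of_le_length, Nat.le_of_lt, mul_assoc]

open Classical in
/-- The history distribution `σ_i^π` of player `i`: `σ^π` summed over the actions and percepts of
the other players. -/
def marginal (σ : Game n A E) (π : Fin n → Strategy A E) (i : Fin n) : Hist A E → ℝ
  | (h, none) =>
    ∑ g : Fin h.length → (Fin n → A) × (Fin n → E),
      if proj i (List.ofFn g) = h then histDist σ π (List.ofFn g, none) else 0
  | (h, some a) =>
    ∑ g : Fin h.length → (Fin n → A) × (Fin n → E), ∑ b : Fin n → A,
      if proj i (List.ofFn g) = h ∧ b i = a then histDist σ π (List.ofFn g, some b) else 0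

/-- The subjective environment `σ_i(e | h a) = σ_i^π(h a e) / σ_i^π(h a)` of player `i`
(meaningful where the denominator is positive). -/
def subjEnv (σ : Game n A E) (π : Fin n → Strategy A E) (i : Fin n)
    (x : List (A × E) × A × E) : ℝ :=
  marginal σ π i (x.1 ++ [(x.2.1, x.2.2)], none) / marginal σ π i (x.1, some x.2.1)

end Play

end

/-! Every factor of a history probability can be enclosed between rational bounds. If a machine
generates a strategy, its output probabilities on a history sum to one, so the interval to which
reflectivity confines the number `q a` shrinks to the point `π h a`
(`OTM.GeneratesStrategy.oracle_eq`). The oracle then answers `1` with certainty to every `p < π h a`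
and `0` to every `p > π h a`; only at `p = π h a` can the answer be random, and there either answer
does no harm. Counting the points of the grid of mesh `2 ^ (-K)` that are answered by `1` gives a
lower bound for `π h a` with error at most `2 ^ (-K)` (`stratCount_le`, `le_stratCount`). The game
needs no oracle: running its machine on all coin sequences of length `K` gives lower bounds that
converge to `σ h a e` (`OTM.Sim.haltProb_eq_count`). In both cases the probabilities of all outcomes
sum to one, so lower bounds for the other outcomes give an upper bound (`brackets_distApprox`).

Such brackets are stable under products and sums of nonnegative quantities, and bounds for numerator
and denominator bound a quotient (`brackets_sumApprox`, `quotApprox_spec`). A marginal is a finite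
sum of history probabilities over the fiber of a projection, so each estimated quantity is a
quotient of finite sums with positive denominator. For the subjective environment, the factors of
the strategy `ρ` depend only on player `i`'s part of the history and come out of the sum
(`marginal_update`). They agree in numerator and denominator and cancel, so one machine that ignores
player `i`'s strategy serves every `ρ`.

The machine (`exists_collecting_machine`) asks the queries `0, 1, 2, …` in turn, and before each of
them a primitive recursive function of the answers so far tries to decide. Primitive recursive
functions are computed by loop programs (`LoopProg.computes_of_primrec'`), which run on tapes
holding unary counters (`LoopProg.Run.haltsIn`). Some number of answers suffices for all answer
sequences of positive probability, so the machine halts with probability one; `exists_estimator`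
puts the pieces together. -/

/-! ## Loop programs and primitive recursion -/

/-- Programs for counter machines; `loop k P` means: while register `k` is nonzero, decrease it
and run `P`. -/
inductive LoopProg
  | skip
  | inc (k : ℕ)
  | seq (P Q : LoopProg)
  | loop (k : ℕ) (P : LoopProg)

namespace LoopProg

open Function

/-- `Run P s s'`: from registers `s` the program `P` terminates with registers `s'`. -/
inductive Run : LoopProg → (ℕ → ℕ) → (ℕ → ℕ) → Prop
  | skip (s) : Run skip s s
  | inc (k s) : Run (inc k) s (update s k (s k + 1))
  | seq {P Q s s' s''} : Run P s s' → Run Q s' s'' → Run (seq P Q) s s''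
  | loop_zero {k P s} : s k = 0 → Run (loop k P) s s
  | loop_succ {k P s s' s'' m} : s k = m + 1 → Run P (update s k m) s' →
      Run (loop k P) s' s'' → Run (loop k P) s s''

/-- Add register `a` to register `b` and clear `a`. -/
def move (a b : ℕ) : LoopProg := loop a (inc b)

def clear (a : ℕ) : LoopProg := loop a skip

/-- Copy register `a` to register `b`, by means of the auxiliary register `c`. -/
def copy (a b c : ℕ) : LoopProg := seq (loop a (seq (inc b) (inc c))) (move c a)

theorem Run.of_eq {P : LoopProg} {s s' s'' : ℕ → ℕ} (h : Run P s s') (e : s' = s'') :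
    Run P s s'' := e ▸ h

theorem run_clear (a : ℕ) (s : ℕ → ℕ) : Run (clear a) s (update s a 0) := by
  obtain ⟨m, hm⟩ : ∃ m, s a = m := ⟨_, rfl⟩
  induction m generalizing s with
  | zero => exact (Run.loop_zero hm).of_eq (by simp [← hm])
  | succ m ih =>
    exact .loop_succ hm (.skip _) ((ih (update s a m) (by simp)).of_eq (by simp))

theorem run_move {a b : ℕ} (hab : a ≠ b) (s : ℕ → ℕ) :
    Run (move a b) s (update (update s a 0) b (s b + s a)) := by
  obtain ⟨m, hm⟩ : ∃ m, s a = m := ⟨_, rfl⟩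
  induction m generalizing s with
  | zero => exact (Run.loop_zero hm).of_eq (by simp [← hm])
  | succ m ih =>
    refine .loop_succ hm (.inc _ _) ((ih _ (by simp [hab])).of_eq ?_)
    funext x
    simp only [update_apply]
    grind

theorem run_copy_loop {a b c : ℕ} (hab : a ≠ b) (hac : a ≠ c) (hbc : b ≠ c) (s : ℕ → ℕ) :
    Run (loop a (seq (inc b) (inc c))) s
      (update (update (update s a 0) b (s b + s a)) c (s c + s a)) := by
  obtain ⟨m, hm⟩ : ∃ m, s a = m := ⟨_, rfl⟩
  induction m generalizing s with
  | zero => exact (Run.loop_zero hm).of_eq (by funext x; simp only [update_apply]; grind)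
  | succ m ih =>
    refine .loop_succ hm (.seq (.inc _ _) (.inc _ _)) ((ih _ (by simp [hab, hac])).of_eq ?_)
    funext x
    simp only [update_apply]
    grind

theorem run_copy {a b c : ℕ} (hab : a ≠ b) (hac : a ≠ c) (hbc : b ≠ c) {s : ℕ → ℕ}
    (hb : s b = 0) (hc : s c = 0) : Run (copy a b c) s (update s b (s a)) := by
  refine .seq (run_copy_loop hab hac hbc s) ((run_move hac.symm _).of_eq ?_)
  funext x
  simp only [update_apply]
  grind

/-- A loop whose body advances `F` by one step while leaving the loop counter alone. -/
theorem run_loop {k : ℕ} {P : LoopProg} (F : ℕ → ℕ → ℕ → ℕ)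
    (h0 : ∀ j m, F j m k = m)
    (hupd : ∀ j m, update (F j (m + 1)) k m = F j m)
    (hstep : ∀ j m, Run P (F j m) (F (j + 1) m)) (j m : ℕ) :
    Run (loop k P) (F j m) (F (j + m) 0) := by
  induction m generalizing j with
  | zero => exact .loop_zero (h0 _ _)
  | succ m ih =>
    refine .loop_succ (h0 _ _) (hupd j m ▸ hstep j m) ((ih (j + 1)).of_eq ?_)
    rw [add_right_comm, add_assoc]

/-- `f` is computed by loop programs: with the arguments in arbitrary registers below `t` and all
registers from `t` on empty, the value is put into register `t`. -/
def Computes {n : ℕ} (f : List.Vector ℕ n → ℕ) : Prop :=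
  ∀ (ρ : Fin n → ℕ) (t : ℕ), (∀ i, ρ i < t) → ∃ P, ∀ s : ℕ → ℕ, (∀ j, t ≤ j → s j = 0) →
    Run P s (update s t (f (List.Vector.ofFn fun i => s (ρ i))))

theorem computes_zero : @Computes 0 fun _ => 0 := fun _ t _ =>
  ⟨skip, fun s hs => (Run.skip s).of_eq (by simp [← hs t le_rfl])⟩

theorem computes_get {n : ℕ} (i : Fin n) : Computes fun v => v.get i := fun ρ t hρ =>
  ⟨copy (ρ i) t (t + 1), fun s hs => (run_copy (hρ i).ne (by have := hρ i; omega) (by omega)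
    (hs _ le_rfl) (hs _ (by omega))).of_eq (by simp)⟩

theorem computes_succ : @Computes 1 fun v => v.head.succ := fun ρ t hρ =>
  ⟨seq (copy (ρ 0) t (t + 1)) (inc t), fun s hs =>
    .seq (run_copy (hρ 0).ne (by have := hρ 0; omega) (by omega)
      (hs _ le_rfl) (hs _ (by omega))) ((Run.inc _ _).of_eq (by simp [List.Vector.ofFn]))⟩

/-- Evaluates several functions into consecutive registers. In the hypothesis `s` is the original
state and `s'` the one where earlier values already occupy registers from `t` on; the arguments lie
below `t` and are still intact. -/
theorem exists_run_block {n : ℕ} {g : Fin n → (ℕ → ℕ) → ℕ} {t : ℕ}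
    (hg : ∀ i : Fin n, ∃ P, ∀ s s' : ℕ → ℕ, (∀ j, j < t → s' j = s j) →
      (∀ j, t + i ≤ j → s' j = 0) → Run P s' (update s' (t + i) (g i s))) (m : ℕ) (hm : m ≤ n) :
    ∃ P, ∀ s : ℕ → ℕ, (∀ j, t ≤ j → s j = 0) → ∃ s', Run P s s' ∧
      (∀ j, j < t → s' j = s j) ∧ (∀ j, t + m ≤ j → s' j = 0) ∧
      ∀ i : Fin n, (i : ℕ) < m → s' (t + i) = g i s := by
  induction m with
  | zero => exact ⟨skip, fun s hs => ⟨s, .skip s, fun _ _ => rfl, hs, by simp⟩⟩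
  | succ m ih =>
    obtain ⟨P, hP⟩ := ih (by omega)
    obtain ⟨Q, hQ⟩ := hg ⟨m, hm⟩
    refine ⟨seq P Q, fun s hs => ?_⟩
    obtain ⟨s', h1, h2, h3, h4⟩ := hP s hs
    refine ⟨_, .seq h1 (hQ s s' h2 h3), fun j hj => ?_, fun j hj => ?_, fun i hi => ?_⟩
    · rw [update_of_ne (by simp; omega), h2 j hj]
    · rw [update_of_ne (by simp; omega), h3 j (by omega)]
    · rcases Nat.lt_succ_iff_lt_or_eq.1 hi with h | h
      · rw [update_of_ne (by simp; omega), h4 i h]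
      · obtain rfl : i = ⟨m, hm⟩ := Fin.ext h
        simp

theorem exists_run_clear (t m : ℕ) :
    ∃ P, ∀ s : ℕ → ℕ, Run P s fun x => if t ≤ x ∧ x < t + m then 0 else s x := by
  induction m with
  | zero => exact ⟨skip, fun s => (Run.skip s).of_eq (by funext x; grind)⟩
  | succ m ih =>
    obtain ⟨P, hP⟩ := ih
    refine ⟨seq P (clear (t + m)), fun s => .seq (hP s) ((run_clear _ _).of_eq ?_)⟩
    funext x
    simp only [update_apply]
    grind

theorem computes_comp {m n : ℕ} {f : List.Vector ℕ n → ℕ} {g : Fin n → List.Vector ℕ m → ℕ}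
    (hf : Computes f) (hg : ∀ i, Computes (g i)) :
    Computes fun a => f (List.Vector.ofFn fun i => g i a) := by
  intro ρ t hρ
  obtain ⟨P, hP⟩ := exists_run_block (n := n) (t := t)
    (g := fun i s => g i (List.Vector.ofFn fun j => s (ρ j))) (fun i => by
      obtain ⟨Q, hQ⟩ := hg i ρ (t + i) fun j => by have := hρ j; omega
      exact ⟨Q, fun s s' h1 h2 => (hQ s' h2).of_eq (by simp [h1 _ (hρ _)])⟩) n le_rfl
  obtain ⟨Q, hQ⟩ := hf (fun i => t + i) (t + n) fun i => by simp
  obtain ⟨R, hR⟩ := exists_run_clear t n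
  -- The inner values fill `t, …, t + n - 1` and the outer value goes to `t + n`. For `n = 0` it is
  -- already in register `t`, and moving a register to itself would never end.
  refine ⟨seq P (seq Q (seq R (if n = 0 then skip else move (t + n) t))), fun s hs => ?_⟩
  obtain ⟨s', h1, h2, h3, h4⟩ := hP s hs
  refine .seq h1 (.seq (hQ s' h3) (.seq (hR _) ?_))
  simp only [h4 _ (Fin.is_lt _)]
  generalize f _ = y
  split_ifs with hn
  · subst hn
    refine (Run.skip _).of_eq (funext fun x => ?_)
    have := h2 x; have := h3 x; have := hs x
    simp only [update_apply]
    grind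
  · refine (run_move (by simpa) _).of_eq (funext fun x => ?_)
    have := h2 x; have := h3 x; have := hs x
    simp only [update_apply]
    grind

theorem computes_prec {n : ℕ} {f : List.Vector ℕ n → ℕ} {g : List.Vector ℕ (n + 2) → ℕ}
    (hf : Computes f) (hg : Computes g) :
    Computes fun v : List.Vector ℕ (n + 1) =>
      v.head.rec (f v.tail) fun y IH => g (y ::ᵥ IH ::ᵥ v.tail) := by
  intro ρ t hρ
  obtain ⟨P, hP⟩ := hf (fun i => ρ i.succ) t fun i => hρ _
  obtain ⟨Q, hQ⟩ := hg (Fin.cons (t + 2) (Fin.cons t fun i => ρ i.succ)) (t + 3) fun i => by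
    refine Fin.cases (by simp) (fun i => Fin.cases (by simp) (fun i => ?_) i) i
    have := hρ i.succ
    simp only [Fin.cons_succ]
    omega
  refine ⟨seq P (seq (copy (ρ 0) (t + 1) (t + 2)) (seq
    (loop (t + 1) (seq Q (seq (clear t) (seq (move (t + 3) t) (inc (t + 2))))))
    (clear (t + 2)))), fun s hs => ?_⟩
  set v := List.Vector.ofFn fun i => s (ρ i) with hv
  have htail : v.tail = List.Vector.ofFn fun i => s (ρ i.succ) := by
    rw [hv]; simp [List.Vector.ofFn]
  have hhead : v.head = s (ρ 0) := by rw [hv]; simp [List.Vector.ofFn]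
  obtain ⟨rc, hrc0, hrc, hrcv⟩ : ∃ rc : ℕ → ℕ, rc 0 = f v.tail ∧
      (∀ j, rc (j + 1) = g (j ::ᵥ rc j ::ᵥ v.tail)) ∧
      v.head.rec (f v.tail) (fun y IH => g (y ::ᵥ IH ::ᵥ v.tail)) = rc v.head :=
    ⟨fun m => m.rec (f v.tail) fun y IH => g (y ::ᵥ IH ::ᵥ v.tail), rfl, fun _ => rfl, rfl⟩
  beta_reduce
  rw [hrcv, hhead]
  clear_value v
  -- Loop invariant: register `t` holds the value of the recursion at `j`, `t + 1` the number `m` of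
  -- rounds left, and `t + 2` the index `j`; the next value is computed in `t + 3`.
  let F : ℕ → ℕ → ℕ → ℕ := fun j m => update (update (update s t (rc j)) (t + 1) m) (t + 2) j
  have h0 := hρ 0
  have h := run_loop (k := t + 1)
    (P := seq Q (seq (clear t) (seq (move (t + 3) t) (inc (t + 2))))) F
    (fun j m => by simp [F]) (fun j m => by
      funext x; simp only [F, update_apply]; grind) (fun j m => by
      refine .seq (hQ _ fun x hx => ?_) (.seq (run_clear _ _) (.seq (run_move (by omega) _)
        ((Run.inc _ _).of_eq (funext fun x => ?_))))
      · have := hs x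
        simp only [F, update_apply]; grind
      · have : (List.Vector.ofFn fun i => F j m
            ((Fin.cons (t + 2) (Fin.cons t fun i => ρ i.succ) : Fin (n + 2) → ℕ) i)) =
            j ::ᵥ rc j ::ᵥ v.tail := by
          rw [htail]
          have hF : ∀ i : Fin n, F j m (ρ i.succ) = s (ρ i.succ) := fun i => by
            have := hρ i.succ
            simp only [F, update_apply]; grind
          simp only [List.Vector.ofFn, Fin.cons_zero, Fin.cons_succ, hF]
          congr 1
          · simp [F]
          · congr 1
            simp [F]
        rw [this]
        have h3 := hs (t + 3) (by omega)
        simp only [F, update_apply, hrc]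
        generalize g _ = y
        grind) 0 (s (ρ 0))
  refine .seq (hP s hs) (.seq (run_copy (by omega) (by omega) (by omega) (by
    simp [hs]) (by simp [hs])) (.seq (Run.of_eq (s' := F (0 + s (ρ 0)) 0) ?_ rfl)
      ((run_clear _ _).of_eq ?_)))
  · convert h using 1
    funext x
    have h2 := hs (t + 2) (by omega)
    simp only [F, update_apply, hrc0, htail]
    grind
  · funext x
    have h2 := hs (t + 2) (by omega)
    have h1 := hs (t + 1) (by omega)
    simp only [F, update_apply]
    grind

theorem computes_of_primrec' {n : ℕ} {f : List.Vector ℕ n → ℕ} (hf : Nat.Primrec' f) :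
    Computes f := by
  induction hf with
  | zero => exact computes_zero
  | succ => exact computes_succ
  | get i => exact computes_get i
  | comp g _ _ hf hg => exact computes_comp hf hg
  | prec _ _ hf hg => exact computes_prec hf hg

end LoopProg

/-! ## Halting probabilities -/

namespace OTM

variable {ans : ℕ → unitInterval} {M : OTM} {S : Set (List ℕ)} {c c₁ c₀ : Cfg} {p : ℝ}

open Classical in
theorem haltProb_of_halted (h : M.step ans c = none) (N : ℕ) :
    M.haltProb ans S N c = if c.output ∈ S then 1 else 0 := by
  cases N <;> simp [haltProb, h]

theorem haltProb_zero_of_step (h : M.step ans c = some (p, c₁, c₀)) :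
    M.haltProb ans S 0 c = 0 := by
  simp [haltProb, h]

theorem haltProb_succ_of_step (h : M.step ans c = some (p, c₁, c₀)) (N : ℕ) :
    M.haltProb ans S (N + 1) c = p * M.haltProb ans S N c₁ + (1 - p) * M.haltProb ans S N c₀ := by
  simp [haltProb, h]

theorem step_prob_mem (h : M.step ans c = some (p, c₁, c₀)) : 0 ≤ p ∧ p ≤ 1 := by
  unfold step at h
  split at h
  · cases h
  · split at h
    · cases h
    · cases h; norm_num
  · cases h; norm_num
  · cases h; exact ⟨unitInterval.nonneg _, unitInterval.le_one _⟩

theorem haltProb_nonneg (N : ℕ) (c : Cfg) : 0 ≤ M.haltProb ans S N c := by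
  induction N generalizing c with
  | zero =>
    rcases h : M.step ans c with _ | ⟨p, c₁, c₀⟩
    · rw [haltProb_of_halted h]; split_ifs <;> norm_num
    · rw [haltProb_zero_of_step h]
  | succ N ih =>
    rcases h : M.step ans c with _ | ⟨p, c₁, c₀⟩
    · rw [haltProb_of_halted h]; split_ifs <;> norm_num
    · rw [haltProb_succ_of_step h]
      have := step_prob_mem h
      exact add_nonneg (mul_nonneg this.1 (ih _)) (mul_nonneg (by linarith) (ih _))

theorem haltProb_le_one (N : ℕ) (c : Cfg) : M.haltProb ans S N c ≤ 1 := by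
  induction N generalizing c with
  | zero =>
    rcases h : M.step ans c with _ | ⟨p, c₁, c₀⟩
    · rw [haltProb_of_halted h]; split_ifs <;> norm_num
    · rw [haltProb_zero_of_step h]; norm_num
  | succ N ih =>
    rcases h : M.step ans c with _ | ⟨p, c₁, c₀⟩
    · rw [haltProb_of_halted h]; split_ifs <;> norm_num
    · rw [haltProb_succ_of_step h]
      have := step_prob_mem h
      nlinarith [ih c₁, ih c₀]

theorem haltProb_le_succ (N : ℕ) (c : Cfg) :
    M.haltProb ans S N c ≤ M.haltProb ans S (N + 1) c := by
  induction N generalizing c with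
  | zero =>
    rcases h : M.step ans c with _ | ⟨p, c₁, c₀⟩
    · rw [haltProb_of_halted h, haltProb_of_halted h]
    · rw [haltProb_zero_of_step h]; exact haltProb_nonneg _ _
  | succ N ih =>
    rcases h : M.step ans c with _ | ⟨p, c₁, c₀⟩
    · rw [haltProb_of_halted h, haltProb_of_halted h]
    · rw [haltProb_succ_of_step h, haltProb_succ_of_step h]
      have := step_prob_mem h
      exact add_le_add (mul_le_mul_of_nonneg_left (ih _) this.1)
        (mul_le_mul_of_nonneg_left (ih _) (by linarith))

theorem haltProb_mono (c : Cfg) : Monotone fun N => M.haltProb ans S N c :=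
  monotone_nat_of_le_succ fun N => haltProb_le_succ N c

theorem bddAbove_haltProb (c : Cfg) : BddAbove (Set.range fun N => M.haltProb ans S N c) :=
  ⟨1, by rintro _ ⟨N, rfl⟩; exact haltProb_le_one _ _⟩

theorem haltProb_le_prob (N : ℕ) (w : List ℕ) :
    M.haltProb ans S N (Cfg.init w) ≤ M.prob ans w S :=
  le_ciSup (bddAbove_haltProb _) N

theorem tendsto_haltProb (w : List ℕ) :
    Filter.Tendsto (fun N => M.haltProb ans S N (Cfg.init w)) Filter.atTop
      (nhds (M.prob ans w S)) :=
  tendsto_atTop_ciSup (haltProb_mono _) (bddAbove_haltProb _)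

/-- From the configuration all runs of positive probability halt with an output in `S`. -/
inductive HaltsIn (ans : ℕ → unitInterval) (M : OTM) (S : Set (List ℕ)) : Cfg → Prop
  | halted {c : Cfg} : M.step ans c = none → c.output ∈ S → HaltsIn ans M S c
  | step {c c₁ c₀ : Cfg} {p : ℝ} : M.step ans c = some (p, c₁, c₀) →
      (p ≠ 0 → HaltsIn ans M S c₁) → (p ≠ 1 → HaltsIn ans M S c₀) → HaltsIn ans M S c

/-- The derivation is a well-founded binary tree, so the step bounds of the two branches have a
maximum. A branch of probability zero need not halt, which is why `key` carries the factor `q`. -/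
theorem HaltsIn.exists_haltProb (h : HaltsIn ans M S c) : ∃ N, M.haltProb ans S N c = 1 := by
  have key : ∀ {q : ℝ} {c : Cfg}, (q ≠ 0 → ∃ N, M.haltProb ans S N c = 1) →
      ∃ N, ∀ N' ≥ N, q * M.haltProb ans S N' c = q := by
    intro q c hq
    by_cases h0 : q = 0
    · exact ⟨0, fun _ _ => by simp [h0]⟩
    · obtain ⟨N, hN⟩ := hq h0
      refine ⟨N, fun N' h => ?_⟩
      rw [le_antisymm (haltProb_le_one N' c) (hN ▸ haltProb_mono c h), mul_one]
  induction h with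
  | halted h ho => exact ⟨0, by rw [haltProb_of_halted h, if_pos ho]⟩
  | @step c c₁ c₀ p h _ _ ih₁ ih₀ =>
    obtain ⟨N₁, h₁⟩ := key ih₁
    obtain ⟨N₀, h₀⟩ := key (q := 1 - p) fun hp => ih₀ fun h1 => hp (by simp [h1])
    refine ⟨max N₁ N₀ + 1, ?_⟩
    rw [haltProb_succ_of_step h, h₁ _ (le_max_left _ _), h₀ _ (le_max_right _ _)]
    ring

theorem prob_eq_one {w : List ℕ} (h : HaltsIn ans M S (Cfg.init w)) : M.prob ans w S = 1 := by
  obtain ⟨N, hN⟩ := h.exists_haltProb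
  exact le_antisymm (ciSup_le fun N => haltProb_le_one _ _) (hN ▸ haltProb_le_prob N w)

end OTM

/-! ## Counter machines -/

namespace MTape

/-- A tape holding the number `m`: the head is on the leftmost of `m` strokes. -/
def Holds (t : MTape) (m : ℕ) : Prop :=
  (∀ x ∈ t.left, x = 0) ∧ ∃ z, t.right = List.replicate m 1 ++ List.replicate z 0

theorem holds_blank : Holds ⟨[], []⟩ 0 := ⟨by simp, 0, rfl⟩

theorem holds_strokes (m : ℕ) : Holds ⟨[], strokes m⟩ m := ⟨by simp, 0, by simp [strokes]⟩

variable {t : MTape} {m : ℕ}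

theorem Holds.word (h : t.Holds m) : t.word = strokes m := by
  obtain ⟨hl, z, hr⟩ := h
  simp only [MTape.word, hr, List.filter_append, strokes]
  rw [List.filter_eq_nil_iff.2 (by simpa using hl)]
  simp

theorem Holds.read_zero (h : t.Holds 0) : t.read = 0 := by
  obtain ⟨-, z, hr⟩ := h
  cases z <;> simp [MTape.read, hr, List.replicate_succ]

theorem Holds.read_succ (h : t.Holds (m + 1)) : t.read = 1 := by
  obtain ⟨-, z, hr⟩ := h
  simp [MTape.read, hr, List.replicate_succ]

/-- On an exhausted list the write appends an explicit blank; the trailing zeros in `Holds` absorb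
it. -/
theorem Holds.rewrite (h : t.Holds m) : ((t.write t.read).move .stay).Holds m := by
  obtain ⟨hl, z, hr⟩ := h
  refine ⟨hl, ?_⟩
  rcases m with _ | m
  · rcases z with _ | z
    · exact ⟨1, by simp [MTape.move, MTape.write, MTape.read, hr]⟩
    · exact ⟨z + 1, by simp [MTape.move, MTape.write, MTape.read, hr, List.replicate_succ]⟩
  · exact ⟨z, by simp [MTape.move, MTape.write, MTape.read, hr, List.replicate_succ]⟩

/-- Decrementing works at the left end of the number: the first stroke becomes a blank behind the
head. Incrementing likewise adds a stroke on the left, so the head never has to cross the number. -/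
theorem Holds.erase (h : t.Holds (m + 1)) : ((t.write 0).move .right).Holds m := by
  obtain ⟨hl, z, hr⟩ := h
  exact ⟨by simpa [MTape.move, MTape.write, MTape.read] using hl, z, by
    simp [MTape.move, MTape.write, hr, List.replicate_succ]⟩

/-- The head is on the blank to the left of `m` strokes. -/
def HoldsLeft (t : MTape) (m : ℕ) : Prop :=
  t.read = 0 ∧ (∀ x ∈ t.left, x = 0) ∧ ∃ z, t.right.tail = List.replicate m 1 ++ List.replicate z 0

theorem Holds.move_left (h : t.Holds m) : ((t.write t.read).move .left).HoldsLeft m := by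
  obtain ⟨hl, z, hr⟩ := h
  have h0 : t.left.headD 0 = 0 := by
    rcases hL : t.left with _ | ⟨a, l⟩
    · rfl
    · exact hl a (by simp [hL])
  refine ⟨by simpa [MTape.move, MTape.write, MTape.read] using h0,
    fun x hx => hl x (List.mem_of_mem_tail hx), ?_⟩
  obtain ⟨-, z, hz⟩ := Holds.rewrite ⟨hl, z, hr⟩
  exact ⟨z, by simpa [MTape.move, MTape.write] using hz⟩

theorem HoldsLeft.write_one (h : t.HoldsLeft m) : ((t.write 1).move .stay).Holds (m + 1) := by
  obtain ⟨-, hl, z, hz⟩ := h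
  exact ⟨hl, z, by simp [MTape.move, MTape.write, hz, List.replicate_succ]⟩

theorem HoldsLeft.move_right (h : t.HoldsLeft m) : ((t.write 0).move .right).Holds m := by
  obtain ⟨-, hl, z, hz⟩ := h
  exact ⟨by simpa [MTape.move, MTape.write, MTape.read] using hl, z, by
    simpa [MTape.move, MTape.write] using hz⟩

theorem HoldsLeft.write_one_move_left (h : t.HoldsLeft m) :
    ((t.write 1).move .left).HoldsLeft (m + 1) := by
  have := h.write_one.move_left
  rwa [h.write_one.read_succ] at this

end MTape

/-- The configuration `c` is in state `q` and its tapes hold the numbers `s`. -/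
def Cfg.Holds (c : Cfg) (q : ℕ) (s : ℕ → ℕ) : Prop := c.state = q ∧ ∀ k, (c.tape k).Holds (s k)

open Function in
theorem Cfg.holds_update {c : Cfg} {s : ℕ → ℕ} {k q m : ℕ} {t : MTape}
    (h : ∀ j, (c.tape j).Holds (s j)) (ht : t.Holds m) :
    Cfg.Holds ⟨q, update c.tape k t⟩ q (update s k m) := by
  refine ⟨rfl, fun j => ?_⟩
  rcases eq_or_ne j k with rfl | hj
  · simpa using ht
  · simpa [hj] using h j

namespace OTM

/-- The segment of instructions `l` occurs in `M` at position `o`. -/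
def HasAt (M : OTM) (o : ℕ) (l : List Instr) : Prop := ∀ j, j < l.length → M[o + j]? = l[j]?

variable {ans : ℕ → unitInterval} {M : OTM} {S : Set (List ℕ)} {c : Cfg}

theorem hasAt_append {o : ℕ} {l l' : List Instr} :
    M.HasAt o (l ++ l') ↔ M.HasAt o l ∧ M.HasAt (o + l.length) l' := by
  constructor
  · refine fun h => ⟨fun j hj => ?_, fun j hj => ?_⟩
    · rw [h j (by simp; omega), List.getElem?_append_left hj]
    · rw [add_assoc, h _ (by simp; omega), List.getElem?_append_right (by omega)]
      simp
  · rintro ⟨h, h'⟩ j hj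
    rcases lt_or_ge j l.length with hl | hl
    · rw [h j hl, List.getElem?_append_left hl]
    · rw [List.getElem?_append_right hl, ← h' _ (by simp at hj; omega)]
      congr 1
      omega

theorem hasAt_singleton {o : ℕ} {i : Instr} : M.HasAt o [i] ↔ M[o]? = some i := by
  simp [HasAt]

theorem hasAt_pair {o : ℕ} {i i' : Instr} :
    M.HasAt o [i, i'] ↔ M[o]? = some i ∧ M[o + 1]? = some i' := by
  rw [← List.singleton_append, hasAt_append, hasAt_singleton, hasAt_singleton]
  rfl

theorem hasAt_self (l l' l'' : List Instr) : HasAt (l ++ l' ++ l'') l.length l' := fun j hj => by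
  rw [List.append_assoc, List.getElem?_append_right (by omega), List.getElem?_append_left (by omega)]
  simp

open Function in
theorem HaltsIn.act {k : ℕ} {rules : List (ℕ × Move × ℕ)} {s q : ℕ} {d : Move}
    (hi : M[c.state]? = some (.act k rules)) (hr : rules[(c.tape k).read]? = some (s, d, q))
    (h : HaltsIn ans M S ⟨q, update c.tape k (((c.tape k).write s).move d)⟩) :
    HaltsIn ans M S c :=
  .step (p := 1) (c₁ := ⟨q, update c.tape k (((c.tape k).write s).move d)⟩)
    (c₀ := ⟨q, update c.tape k (((c.tape k).write s).move d)⟩)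
    (by simp [OTM.step, hi, hr]) (fun _ => h) (fun _ => h)

/-- A jump to state `q`, provided that tape `k` holds a number. -/
def jump (k q : ℕ) : Instr := .act k [(0, .stay, q), (1, .stay, q)]

open Function in
theorem HaltsIn.jump {k o q : ℕ} {s : ℕ → ℕ} (hc : c.Holds o s) (hi : M[o]? = some (jump k q))
    (h : ∀ c' : Cfg, c'.Holds q s → HaltsIn ans M S c') : HaltsIn ans M S c := by
  have hc' := h ⟨q, update c.tape k (((c.tape k).write (c.tape k).read).move .stay)⟩ (by
    simpa using Cfg.holds_update (q := q) (k := k) hc.2 (hc.2 k).rewrite)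
  rcases hk : s k with _ | m
  · have hr := MTape.Holds.read_zero (hk ▸ hc.2 k)
    exact .act (hc.1 ▸ hi) (by simp [hr]) (hr ▸ hc')
  · have hr := MTape.Holds.read_succ (hk ▸ hc.2 k)
    exact .act (hc.1 ▸ hi) (by simp [hr]) (hr ▸ hc')

open Function in
theorem HaltsIn.dec {k o q₀ q : ℕ} {s : ℕ → ℕ} (hc : c.Holds o s)
    (hi : M[o]? = some (.act k [(0, .stay, q₀), (0, .right, q)]))
    (h₀ : s k = 0 → ∀ c' : Cfg, c'.Holds q₀ s → HaltsIn ans M S c')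
    (h₁ : ∀ m, s k = m + 1 → ∀ c' : Cfg, c'.Holds q (update s k m) → HaltsIn ans M S c') :
    HaltsIn ans M S c := by
  rcases hk : s k with _ | m
  · have hr := MTape.Holds.read_zero (hk ▸ hc.2 k)
    refine .act (s := 0) (d := .stay) (q := q₀) (hc.1 ▸ hi) (by simp [hr]) (h₀ hk _ ?_)
    have := Cfg.holds_update (q := q₀) (k := k) hc.2 (hc.2 k).rewrite
    simpa [hr] using this
  · have hr := MTape.Holds.read_succ (hk ▸ hc.2 k)
    exact .act (s := 0) (d := .right) (q := q) (hc.1 ▸ hi) (by simp [hr])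
      (h₁ m hk _ (Cfg.holds_update hc.2 (MTape.Holds.erase (hk ▸ hc.2 k))))

end OTM

/-! ### Compilation of loop programs to tape machines -/

namespace LoopProg

/-- The instructions of a program, to be placed at position `o` of a machine. -/
def compile : LoopProg → ℕ → List Instr
  | skip, _ => []
  | inc k, o => [.act k [(0, .left, o + 1), (1, .left, o + 1)], .act k [(1, .stay, o + 2)]]
  | seq P Q, o => P.compile o ++ Q.compile (o + (P.compile o).length)
  | loop k P, o =>
    .act k [(0, .stay, o + 1 + (P.compile (o + 1)).length + 1), (0, .right, o + 1)] ::
      (P.compile (o + 1) ++ [OTM.jump k o])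

open Function OTM

variable {ans : ℕ → unitInterval} {M : OTM} {S : Set (List ℕ)}

theorem haltsIn_inc {k o : ℕ} {s : ℕ → ℕ} {c : Cfg} (hc : c.Holds o s)
    (hM : M.HasAt o ((inc k).compile o))
    (h : ∀ c' : Cfg, c'.Holds (o + 2) (update s k (s k + 1)) → HaltsIn ans M S c') :
    HaltsIn ans M S c := by
  obtain rfl := hc.1
  obtain ⟨h1, h2⟩ := hasAt_pair.1 hM
  have key : HaltsIn ans M S
      ⟨c.state + 1, update c.tape k (((c.tape k).write (c.tape k).read).move .left)⟩ := by
    have hl := (hc.2 k).move_left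
    refine .act h2 (s := 1) (d := .stay) (q := c.state + 2) (by simp [hl.1]) (h _ ?_)
    simpa using Cfg.holds_update (q := c.state + 2) (k := k) hc.2 hl.write_one
  rcases hk : s k with _ | m
  · have hr := MTape.Holds.read_zero (hk ▸ hc.2 k)
    exact .act h1 (by simp [hr]) (hr ▸ key)
  · have hr := MTape.Holds.read_succ (hk ▸ hc.2 k)
    exact .act h1 (by simp [hr]) (hr ▸ key)

/-- Correctness of the compiler in continuation form: it suffices to halt from every configuration
at the end of the code with the final register contents. Quantifying over configurations avoids
tracking the superfluous blanks that the run leaves on the tapes. -/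
theorem Run.haltsIn {P : LoopProg} {s s' : ℕ → ℕ} (hP : Run P s s') :
    ∀ {o : ℕ} {c : Cfg}, c.Holds o s → M.HasAt o (P.compile o) →
      (∀ c' : Cfg, c'.Holds (o + (P.compile o).length) s' → HaltsIn ans M S c') →
      HaltsIn ans M S c := by
  induction hP with
  | skip s => exact fun hc _ h => h _ hc
  | inc k s => exact fun hc hM h => haltsIn_inc hc hM h
  | seq _ _ ihP ihQ =>
    intro o c hc hM h
    obtain ⟨h1, h2⟩ := hasAt_append.1 hM
    exact ihP hc h1 fun c' hc' => ihQ hc' h2 fun c'' hc'' => h _ (by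
      simpa [compile, add_assoc] using hc'')
  | @loop_zero k P s hk =>
    intro o c hc hM h
    rw [compile, ← List.singleton_append, hasAt_append, hasAt_singleton] at hM
    refine .dec hc hM.1 (fun _ c' hc' => h c' ?_) (fun m hm => by omega)
    simpa [compile, add_assoc, add_comm, add_left_comm] using hc'
  | @loop_succ k P s s' s'' m hk _ _ ihP ihL =>
    intro o c hc hM h
    have hM' := hM
    rw [compile, ← List.singleton_append, hasAt_append, hasAt_singleton, hasAt_append,
      hasAt_singleton] at hM
    refine .dec hc hM.1 (fun h0 => by omega) fun m' hm' c' hc' => ?_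
    obtain rfl : m = m' := by omega
    -- The final jump returns to position `o`, where the code of the whole loop (`hM'`) applies
    -- again.
    exact ihP hc' hM.2.1 fun c₁ h₁ => .jump h₁ hM.2.2 fun c₂ h₂ => ihL h₂ hM' h

end LoopProg

/-! ## Machines that collect the answers to all queries until they can decide -/

/-- The sequence of answers `bs` to the queries `0, 1, 2, …` has positive probability. -/
def ValidAnswers (ans : ℕ → unitInterval) (bs : List Bool) : Prop :=
  ∀ m b, bs[m]? = some b → (b = true → ans m ≠ 0) ∧ (b = false → ans m ≠ 1)

theorem ValidAnswers.concat {ans : ℕ → unitInterval} {bs : List Bool} (h : ValidAnswers ans bs)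
    {b : Bool} (hb : (b = true → ans bs.length ≠ 0) ∧ (b = false → ans bs.length ≠ 1)) :
    ValidAnswers ans (bs ++ [b]) := by
  intro m b' hm
  rcases lt_trichotomy m bs.length with hlt | rfl | hgt
  · rw [List.getElem?_append_left hlt] at hm
    exact h m b' hm
  · simp only [List.getElem?_concat_length, Option.some.injEq] at hm
    exact hm ▸ hb
  · rw [List.getElem?_eq_none (by simp; omega)] at hm
    cases hm

namespace Collect

open Function OTM LoopProg

/-- Append the answer in register `5` to the list in register `4`. -/
def record (PG : LoopProg) : LoopProg :=
  .seq PG (.seq (clear 4) (.seq (clear 5) (.seq (LoopProg.move 6 4) (.inc 2))))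

/-- The main loop, at position `1`: decide by `PF` from the input (register `0`), the parameter
(register `3`) and the answers so far (register `4`); if there is no decision, submit the next
query and record its answer by `PG`. -/
def mainLoop (PF PG : LoopProg) : List Instr :=
  let o₁ := 1 + (PF.compile 1).length
  let o₂ := o₁ + 1 + ((LoopProg.move 5 1).compile (o₁ + 1)).length
  PF.compile 1 ++ ([.act 5 [(0, .stay, o₂ + 1), (0, .right, o₁ + 1)]] ++
    ((LoopProg.move 5 1).compile (o₁ + 1) ++ ([.act 5 []] ++ ([.ask (o₂ + 4) (o₂ + 2)] ++
      ((LoopProg.inc 5).compile (o₂ + 2) ++ ((record PG).compile (o₂ + 4) ++ [jump 5 1]))))))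

/-- The machine with parameter `x`: write `x` on tape `3` and enter the main loop. -/
def machine (l : List Instr) (x : ℕ) : OTM :=
  ([.act 3 [(0, .stay, l.length + 1)]] ++ l) ++
    ((List.range x).map fun j => .act 3 [(1, .left, l.length + 1 + j + 1)]) ++
      [.act 3 [(0, .right, 1)]]

/-- The registers in the main loop. -/
def regs (w x : ℕ) (bs : List Bool) : ℕ → ℕ
  | 0 => w
  | 2 => bs.length
  | 3 => x
  | 4 => Encodable.encode bs
  | _ => 0

variable {ans : ℕ → unitInterval} {M : OTM} {S : Set (List ℕ)}

theorem holds_init (w : ℕ) (k : ℕ) :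
    ((Cfg.init (strokes w)).tape k).Holds (update (fun _ => 0) 0 w k) := by
  rcases eq_or_ne k 0 with rfl | hk
  · simpa [Cfg.init] using MTape.holds_strokes w
  · simpa [Cfg.init, hk] using MTape.holds_blank

/-- State `l.length + 1 + j` means that `j` of the `x` strokes have been written, the head standing
on the blank to their left. The last instruction moves the head right, onto the number. -/
theorem haltsIn_writer (l : List Instr) (w x : ℕ)
    (h : ∀ c : Cfg, c.Holds 1 (regs w x []) → HaltsIn ans (machine l x) S c) :
    HaltsIn ans (machine l x) S (Cfg.init (strokes w)) := by
  set M := machine l x with hM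
  have key : ∀ d j, j + d = x → ∀ t : MTape, t.HoldsLeft j → HaltsIn ans M S
      ⟨l.length + 1 + j, update (Cfg.init (strokes w)).tape 3 t⟩ := by
    intro d
    induction d with
    | zero =>
      rintro j rfl t ht
      have hi : M[l.length + 1 + j]? = some (.act 3 [(0, .right, 1)]) := by
        rw [hM, machine, List.getElem?_append_right (by simp)]
        simp [show l.length + 1 + j - (l.length + j + 1) = 0 by omega]
      refine .act hi (s := 0) (d := .right) (q := 1) (by simp [ht.1]) (h _ ⟨rfl, fun k => ?_⟩)
      rcases eq_or_ne k 3 with rfl | hk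
      · simpa [regs] using ht.move_right
      · have := holds_init w k
        simp only [update_of_ne hk]
        convert this using 1
        unfold regs
        split <;> simp_all
    | succ d ih =>
      intro j hj t ht
      have hi : M[l.length + 1 + j]? = some (.act 3 [(1, .left, l.length + 1 + j + 1)]) := by
        rw [hM, machine, List.getElem?_append_left (by simp; omega),
          List.getElem?_append_right (by simp)]
        simp [List.getElem?_range (show j < x by omega)]
      refine .act hi (s := 1) (d := .left) (q := l.length + 1 + j + 1) (by simp [ht.1]) ?_
      have := ih (j + 1) (by omega) _ ht.write_one_move_left
      rw [← add_assoc] at this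
      simpa using this
  have hi : M[0]? = some (.act 3 [(0, .stay, l.length + 1)]) := by
    rw [hM, machine]; simp
  refine .act (c := Cfg.init (strokes w)) hi (s := 0) (d := .stay) (q := l.length + 1) ?_ ?_
  · simp [Cfg.init, MTape.read]
  · exact key x 0 (by simp) _ ⟨by simp [Cfg.init, MTape.read, MTape.write, MTape.move],
      by simp [Cfg.init, MTape.write, MTape.move],
      0, by simp [Cfg.init, MTape.write, MTape.move]⟩

theorem output_eq {c : Cfg} {q : ℕ} {s : ℕ → ℕ} (hc : c.Holds q s) : c.output = strokes (s 1) :=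
  (hc.2 1).word

variable {PF PG : LoopProg} {F : ℕ → ℕ → ℕ → ℕ} {G : ℕ → ℕ → ℕ}

/-- Induction on the number `d` of answers still missing from `N`, at which point a decision is
guaranteed. A decision may come earlier; `hS` makes every decision from valid answers acceptable. -/
theorem haltsIn_mainLoop (hM : M.HasAt 1 (mainLoop PF PG))
    (hF : ∀ s : ℕ → ℕ, (∀ j, 5 ≤ j → s j = 0) → Run PF s (update s 5 (F (s 0) (s 3) (s 4))))
    (hG : ∀ s : ℕ → ℕ, (∀ j, 6 ≤ j → s j = 0) → Run PG s (update s 6 (G (s 4) (s 5))))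
    (hGb : ∀ (bs : List Bool) (b : Bool), G (Encodable.encode bs) b.toNat =
      Encodable.encode (bs ++ [b])) {w x N : ℕ}
    (hS : ∀ bs, ValidAnswers ans bs → ∀ m, F w x (Encodable.encode bs) = m + 1 → strokes m ∈ S)
    (hN : ∀ bs, ValidAnswers ans bs → bs.length = N → F w x (Encodable.encode bs) ≠ 0) :
    ∀ (d : ℕ) (bs : List Bool), ValidAnswers ans bs → bs.length + d = N →
      ∀ c : Cfg, c.Holds 1 (regs w x bs) → HaltsIn ans M S c := by
  simp only [mainLoop, hasAt_append, hasAt_singleton, List.length_singleton] at hM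
  generalize ho₁ : 1 + (PF.compile 1).length = o₁ at hM
  generalize ho₂ : o₁ + 1 + ((LoopProg.move 5 1).compile (o₁ + 1)).length = o₂ at hM
  have hl : ((LoopProg.inc 5).compile (o₂ + 2)).length = 2 := rfl
  rw [hl] at hM
  obtain ⟨hM₁, hM₂, hM₃, hM₄, hM₅, hM₆, hM₇, hM₈⟩ := hM
  intro d
  induction d with
  | zero =>
    intro bs hbs hd c hc
    refine (hF _ ?_).haltsIn hc hM₁ fun c₁ h₁ => ?_
    · rintro (_ | _ | _ | _ | _ | j) hj <;> first | omega | rfl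
    refine .dec (ho₁ ▸ h₁) hM₂ (fun h0 => absurd h0 (by simpa [regs] using hN bs hbs hd)) ?_
    intro m hm c₂ h₂
    refine (run_move (by decide) _).haltsIn h₂ hM₃ fun c₃ h₃ => ?_
    rw [ho₂] at h₃
    refine .halted (by simp [OTM.step, h₃.1, hM₄]) ?_
    rw [output_eq h₃]
    simpa [regs] using hS bs hbs m (by simpa [regs] using hm)
  | succ d ih =>
    intro bs hbs hd c hc
    refine (hF _ ?_).haltsIn hc hM₁ fun c₁ h₁ => ?_
    · rintro (_ | _ | _ | _ | _ | j) hj <;> first | omega | rfl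
    refine .dec (ho₁ ▸ h₁) hM₂ (fun h0 c₂ h₂ => ?_) ?_
    · have hs : update (regs w x bs) 5 (F (regs w x bs 0) (regs w x bs 3) (regs w x bs 4)) =
          regs w x bs := by
        simp only [update_self] at h0
        rw [h0]
        exact update_eq_self_iff.2 rfl
      rw [hs] at h₂
      -- Register `2` counts the answers and lies on the oracle tape, so it is itself the next
      -- query.
      have hq : (c₂.tape 2).word.length = bs.length := by
        rw [(h₂.2 2).word]; simp [strokes, regs]
      -- Both answers continue at the recording code, with the answer in register `5`; only answers
      -- of positive probability are followed, so the extended list stays valid.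
      have next : ∀ b : Bool, ((b = true → ans bs.length ≠ 0) ∧ (b = false → ans bs.length ≠ 1)) →
          ∀ c' : Cfg, c'.Holds (o₂ + 4) (update (regs w x bs) 5 b.toNat) →
            HaltsIn ans M S c' := by
        intro b hb c' hc'
        refine (Run.seq (hG _ ?_) (.seq (run_clear _ _) (.seq (run_clear _ _)
          (.seq (run_move (by decide) _) (.inc _ _))))).haltsIn hc' hM₇ fun c₄ h₄ => ?_
        · rintro (_ | _ | _ | _ | _ | _ | j) hj <;> first | omega | rfl
        refine .jump h₄ hM₈ fun c₅ h₅ => ih (bs ++ [b]) (hbs.concat hb) (by simp; omega) c₅ ?_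
        convert h₅ using 1
        have := hGb bs b
        funext j
        rcases j with _ | _ | _ | _ | _ | _ | _ | j <;>
          simp [regs, this]
      refine .step (by simp only [OTM.step, h₂.1, hM₅]; rfl) (fun hp => ?_) (fun hp => ?_)
      · refine (LoopProg.Run.inc 5 _).haltsIn (s := regs w x bs) ⟨rfl, h₂.2⟩ hM₆ fun c' hc' => ?_
        refine next true ⟨fun _ h => hp ?_, by simp⟩ c' hc'
        rw [hq, h]; rfl
      · refine next false ⟨by simp, fun _ h => hp ?_⟩ _ ⟨rfl, ?_⟩
        · rw [hq, h]; rfl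
        · rw [update_eq_self_iff.2 (by rfl)]; exact h₂.2
    · intro m hm c₂ h₂
      refine (run_move (by decide) _).haltsIn h₂ hM₃ fun c₃ h₃ => ?_
      rw [ho₂] at h₃
      refine .halted (by simp [OTM.step, h₃.1, hM₄]) ?_
      rw [output_eq h₃]
      simpa [regs] using hS bs hbs m (by simpa [regs] using hm)

theorem primrec_instr_act {α : Type*} [Primcodable α] {k : ℕ} {f : α → ℕ × Move × ℕ}
    (hf : Primrec f) : Primrec fun a => Instr.act k [f a] := by
  have : Primrec fun a => instrEquiv (Instr.act k [f a]) :=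
    Primrec.sumInl.comp ((Primrec.const k).pair
      (Primrec.list_cons.comp hf (Primrec.const [])))
  exact (Primrec.of_equiv_iff instrEquiv).1 this

/-- The main loop is fixed; the parameter only determines how many writing instructions follow it.
-/
theorem primrec_machine (l : List Instr) : Primrec (machine l) := by
  refine Primrec.list_append.comp (Primrec.list_append.comp (Primrec.const _)
    (Primrec.list_map Primrec.list_range ?_)) (Primrec.const _)
  refine primrec_instr_act ((Primrec.const 1).pair ((Primrec.const Move.left).pair ?_))
  exact Primrec.nat_add.comp (Primrec.nat_add.comp (Primrec.const (l.length + 1)) Primrec.snd)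
    (Primrec.const 1)

theorem hasAt_machine (l : List Instr) (x : ℕ) : (machine l x).HasAt 1 l := by
  have := hasAt_self [Instr.act 3 [(0, .stay, l.length + 1)]] l
    (((List.range x).map fun j => .act 3 [(1, .left, l.length + 1 + j + 1)]) ++
      [.act 3 [(0, .right, 1)]])
  rw [← List.append_assoc] at this
  exact this

end Collect

open Collect Encodable in
/-- Whatever can be decided from finitely many answers of the oracle by a primitive recursive
`dec` is output by a machine that depends computably on a parameter. -/
theorem exists_collecting_machine {P X : Type*} [Primcodable P] [Primcodable X]
    {dec : P × (X × ℕ) × List Bool → Option (ℕ × ℕ)} (hdec : Primrec dec) :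
    ∃ mk : P → OTM, Computable mk ∧ ∀ (ans : ℕ → unitInterval) (p : P) (x : X × ℕ)
      (S : Set (ℕ × ℕ)),
      (∀ bs, ValidAnswers ans bs → ∀ r, dec (p, x, bs) = some r → r ∈ S) →
      (∃ N, ∀ bs, ValidAnswers ans bs → bs.length = N → (dec (p, x, bs)).isSome) →
      (mk p).prob ans (strokes (encode x)) {w | ∃ r ∈ S, w = strokes (encode r)} = 1 := by
  -- The code of an option is `0` for `none` and `encode r + 1` for `some r`: a zero test detects a
  -- decision, and its decrement leaves exactly the number to be output.
  let F : ℕ → ℕ → ℕ → ℕ := fun w p b =>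
    encode ((decode (α := X × ℕ) w).bind fun w => (decode (α := P) p).bind fun p =>
      (decode (α := List Bool) b).bind fun b => dec (p, w, b))
  let G : ℕ → ℕ → ℕ := fun bs b => encode (((decode (α := List Bool) bs).getD []) ++ [b != 0])
  have hF : Primrec fun v : List.Vector ℕ 3 => F (v.get 0) (v.get 1) (v.get 2) := by
    have hv : ∀ i : Fin 3, Primrec fun v : List.Vector ℕ 3 => v.get i := fun i =>
      Primrec.vector_get.comp .id (.const i)
    refine Primrec.encode.comp (Primrec.option_bind (Primrec.decode.comp (hv 0))
      (Primrec.option_bind (Primrec.decode.comp ((hv 1).comp .fst))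
        (Primrec.option_bind (Primrec.decode.comp ((hv 2).comp (Primrec.fst.comp .fst))) ?_)))
    exact hdec.comp ((Primrec.snd.comp .fst).pair
      ((Primrec.snd.comp (Primrec.fst.comp .fst)).pair .snd))
  have hG : Primrec fun v : List.Vector ℕ 2 => G (v.get 0) (v.get 1) := by
    have hv : ∀ i : Fin 2, Primrec fun v : List.Vector ℕ 2 => v.get i := fun i =>
      Primrec.vector_get.comp .id (.const i)
    refine Primrec.encode.comp (Primrec.list_concat.comp
      (Primrec.option_getD.comp (Primrec.decode.comp (hv 0)) (.const _)) ?_)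
    exact Primrec.not.comp (Primrec.beq.comp (hv 1) (.const 0))
  -- The input, parameter and answer list are in registers `0`, `3` and `4`; the decision goes to
  -- `5`.
  obtain ⟨PF, hPF⟩ := LoopProg.computes_of_primrec' (Nat.Primrec'.of_prim hF) ![0, 3, 4] 5
    (by decide)
  obtain ⟨PG, hPG⟩ := LoopProg.computes_of_primrec' (Nat.Primrec'.of_prim hG) ![4, 5] 6
    (by decide)
  refine ⟨fun p => machine (mainLoop PF PG) (encode p),
    ((primrec_machine _).comp .encode).to_comp, fun ans p x S hS ⟨N, hN⟩ => ?_⟩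
  refine OTM.prob_eq_one (haltsIn_writer _ _ _ fun c hc => ?_)
  have hFx : ∀ bs : List Bool, F (encode x) (encode p) (encode bs) = encode (dec (p, x, bs)) := by
    intro bs; simp only [F, encodek, Option.bind_some]
  refine haltsIn_mainLoop (F := F) (G := G) (N := N) (w := encode x) (x := encode p)
    (hasAt_machine _ _) (by simpa using hPF) (by simpa using hPG) ?_ ?_ ?_ N [] ?_ (by simp) c hc
  · rintro bs (_ | _) <;> simp [G]
  · intro bs hbs m hm
    rw [hFx] at hm
    rcases hr : dec (p, x, bs) with _ | r
    · simp [hr] at hm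
    · refine ⟨r, hS bs hbs r hr, ?_⟩
      simp only [hr, encode_some, Nat.succ_eq_add_one, add_left_inj] at hm
      rw [hm]
  · intro bs hbs hlen h0
    rw [hFx] at h0
    obtain ⟨r, hr⟩ := Option.isSome_iff_exists.1 (hN bs hbs hlen)
    simp [hr] at h0
  · intro m b hm
    simp at hm

/-! ## Simulation of machines without oracle -/

namespace OTM.Sim

/-- A tape, given by the cells to the left of the head and the others. -/
abbrev FTape := List ℕ × List ℕ

/-- A configuration, given by its state and an association list of its nonempty tapes. -/
abbrev FCfg := ℕ × List (ℕ × FTape)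

def FTape.read (t : FTape) : ℕ := t.2.head?.getD 0

def FTape.write (t : FTape) (s : ℕ) : FTape := (t.1, s :: t.2.tail)

def FTape.move (t : FTape) (d : Move) : FTape :=
  (moveEquiv d).elim t fun b =>
    cond b (FTape.read t :: t.1, t.2.tail) (t.1.tail, t.1.head?.getD 0 :: t.2)

def FTape.word (t : FTape) : List ℕ := (t.1.reverse ++ t.2).filter (· ≠ 0)

def FTape.toMTape (t : FTape) : MTape := ⟨t.1, t.2⟩

def FCfg.tape (c : FCfg) (k : ℕ) : FTape := (c.2.lookup k).getD ([], [])

def FCfg.toCfg (c : FCfg) : Cfg := ⟨c.1, fun k => (FCfg.tape c k).toMTape⟩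

/-- The rule that applies in a configuration whose state acts on a tape. -/
def rule (c : FCfg) (r : ℕ × List (ℕ × Move × ℕ)) : Option (ℕ × Move × ℕ) :=
  r.2[FTape.read (FCfg.tape c r.1)]?

/-- The new content of tape `k` is put in front of the association list, where it shadows older
entries. -/
def applyRule (c : FCfg) (k : ℕ) (r : ℕ × Move × ℕ) : FCfg :=
  (r.2.2, (k, FTape.move (FTape.write (FCfg.tape c k) r.1) r.2.1) :: c.2)

/-- The two equally likely successors of a configuration, all queries being answered by `0`. -/
def next (M : OTM) (c : FCfg) : List FCfg :=
  (M[c.1]?).elim [c, c] fun i => (instrEquiv i).elim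
    (fun r => (rule c r).elim [c, c] fun a => [applyRule c r.1 a, applyRule c r.1 a])
    fun j => j.elim (fun q => [(q.2, c.2), (q.1, c.2)]) fun q => [(q.1, c.2), (q.1, c.2)]

def halted (M : OTM) (c : FCfg) : Bool :=
  (M[c.1]?).elim true fun i => (instrEquiv i).elim (fun r => (rule c r).isNone) fun _ => false

/-- The number of coin sequences of length `N` for which `M` on input `w` halts within `N` steps
with output `[y]`. -/
def count (M : OTM) (w : List ℕ) (y N : ℕ) : ℕ :=
  ((((fun L => L.flatMap (next M))^[N] [(0, [(0, [], w)])]).filter fun c =>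
    halted M c && decide (FTape.word (FCfg.tape c 1) = [y])).length)

theorem toMTape_read (t : FTape) : t.toMTape.read = FTape.read t := by
  rcases t with ⟨l, _ | ⟨a, r⟩⟩ <;> rfl

theorem toMTape_write (t : FTape) (s : ℕ) : t.toMTape.write s = (FTape.write t s).toMTape := rfl

theorem toMTape_move (t : FTape) (d : Move) : t.toMTape.move d = (FTape.move t d).toMTape := by
  rcases d with _ | _ | _
  · rcases t with ⟨_ | ⟨a, l⟩, r⟩ <;> rfl
  · rfl
  · rcases t with ⟨l, _ | ⟨a, r⟩⟩ <;> rfl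

theorem toCfg_applyRule (c : FCfg) (k : ℕ) (r : ℕ × Move × ℕ) :
    (applyRule c k r).toCfg = ⟨r.2.2, Function.update c.toCfg.tape k
      (((c.toCfg.tape k).write r.1).move r.2.1)⟩ := by
  simp only [FCfg.toCfg, applyRule, toMTape_write, toMTape_move, Cfg.mk.injEq, true_and]
  funext j
  rcases eq_or_ne j k with rfl | hj
  · simp [FCfg.tape]
  · have : (j == k) = false := by simpa using hj
    simp [FCfg.tape, List.lookup_cons, this, hj]

theorem toCfg_init (w : List ℕ) : FCfg.toCfg (0, [(0, [], w)]) = Cfg.init w := by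
  simp only [FCfg.toCfg, Cfg.init, Cfg.mk.injEq, true_and]
  funext j
  rcases eq_or_ne j 0 with rfl | hj
  · rfl
  · have : (j == 0) = false := by simpa using hj
    simp [FCfg.tape, List.lookup_cons, this, hj, FTape.toMTape]

theorem output_toCfg (c : FCfg) : c.toCfg.output = FTape.word (FCfg.tape c 1) := rfl

variable {M : OTM} {S : Set (List ℕ)}

/-- Halted configurations and deterministic steps are duplicated, so every configuration has exactly
two successors of weight `1 / 2`, and `N` rounds give one list entry per coin sequence. -/
theorem next_spec (c : FCfg) : ∃ c₁ c₀, next M c = [c₁, c₀] ∧ ∀ N,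
    M.haltProb (fun _ => 0) S (N + 1) c.toCfg = (M.haltProb (fun _ => 0) S N c₁.toCfg +
      M.haltProb (fun _ => 0) S N c₀.toCfg) / 2 := by
  have stay : M.step (fun _ => 0) c.toCfg = none → ∀ N,
      M.haltProb (fun _ => 0) S (N + 1) c.toCfg = (M.haltProb (fun _ => 0) S N c.toCfg +
        M.haltProb (fun _ => 0) S N c.toCfg) / 2 := fun h N => by
    rw [haltProb_of_halted h, haltProb_of_halted h]; ring
  have hstate : c.toCfg.state = c.1 := rfl
  rcases hi : M[c.1]? with _ | ⟨k, r⟩ | ⟨q₀, q₁⟩ | ⟨q₀, q₁⟩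
  · exact ⟨c, c, by simp [next, hi], stay (by simp [step, hstate, hi])⟩
  · have hr : rule c (k, r) = r[(c.toCfg.tape k).read]? := by
      rw [rule, ← toMTape_read]; rfl
    rcases ha : rule c (k, r) with _ | a
    · exact ⟨c, c, by simp [next, hi, instrEquiv, ha],
        stay (by simp only [step, hstate, hi]; rw [← hr, ha])⟩
    · refine ⟨_, _, by simp [next, hi, instrEquiv, ha]; exact ⟨rfl, rfl⟩, fun N => ?_⟩
      rw [haltProb_succ_of_step (by
        simp only [step, hstate, hi]; rw [← hr, ha]), ← toCfg_applyRule]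
      ring
  · refine ⟨(q₁, c.2), (q₀, c.2), by simp [next, hi, instrEquiv], fun N => ?_⟩
    rw [haltProb_succ_of_step (by simp only [step, hstate, hi]; rfl)]
    simp only [FCfg.toCfg, FCfg.tape]
    ring
  · refine ⟨(q₀, c.2), (q₀, c.2), by simp [next, hi, instrEquiv], fun N => ?_⟩
    rw [haltProb_succ_of_step (by simp only [step, hstate, hi]; rfl)]
    simp [FCfg.toCfg, FCfg.tape]

theorem halted_iff (c : FCfg) : halted M c = true ↔ M.step (fun _ => 0) c.toCfg = none := by
  have hstate : c.toCfg.state = c.1 := rfl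
  rcases hi : M[c.1]? with _ | ⟨k, r⟩ | ⟨q₀, q₁⟩ | ⟨q₀, q₁⟩
  · simp [halted, step, hstate, hi]
  · have hr : rule c (k, r) = r[(c.toCfg.tape k).read]? := by
      rw [rule, ← toMTape_read]; rfl
    simp only [halted, step, hstate, hi, Option.elim_some, instrEquiv, Equiv.coe_fn_mk, Sum.elim_inl]
    rw [← hr]
    rcases rule c (k, r) with _ | a <;> simp
  · simp [halted, step, hstate, hi, instrEquiv]
  · simp [halted, step, hstate, hi, instrEquiv]

theorem haltProb_zero_toCfg (c : FCfg) (y : ℕ) :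
    M.haltProb (fun _ => 0) {w | w = [y]} 0 c.toCfg =
      if halted M c && decide (FTape.word (FCfg.tape c 1) = [y]) then 1 else 0 := by
  rcases h : M.step (fun _ => 0) c.toCfg with _ | ⟨p, c₁, c₀⟩
  · rw [haltProb_of_halted h, (halted_iff c).2 h, output_toCfg]
    simp
  · have : halted M c = false := by
      rw [← Bool.not_eq_true, halted_iff, h]; simp
    rw [haltProb_zero_of_step h, this]
    simp

/-- Iterating the averaging identity of `next_spec` reduces the halting probability to step bound
`0`, where it is an indicator and the sum becomes a count. -/
theorem sum_haltProb (N : ℕ) (L : List FCfg) :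
    (L.map fun c => M.haltProb (fun _ => 0) S N c.toCfg).sum =
      (((fun L => L.flatMap (next M))^[N] L).map fun c =>
        M.haltProb (fun _ => 0) S 0 c.toCfg).sum / 2 ^ N := by
  induction N generalizing L with
  | zero => simp
  | succ N ih =>
    rw [Function.iterate_succ_apply, pow_succ, ← div_div, ← ih]
    induction L with
    | nil => simp
    | cons c L ihL =>
      obtain ⟨c₁, c₀, hc, hN⟩ := next_spec (M := M) (S := S) c
      rw [List.map_cons, List.sum_cons, ihL, hN, List.flatMap_cons, hc]
      simp
      ring

theorem haltProb_eq_count (M : OTM) (w : List ℕ) (y N : ℕ) :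
    M.haltProb (fun _ => 0) {w | w = [y]} N (Cfg.init w) = count M w y N / 2 ^ N := by
  have h := sum_haltProb (M := M) (S := {w | w = [y]}) N [(0, [(0, [], w)])]
  simp only [List.map_cons, List.map_nil, List.sum_cons, List.sum_nil, add_zero, toCfg_init] at h
  rw [h, count]
  congr 1
  simp only [haltProb_zero_toCfg]
  generalize (fun L : List FCfg => L.flatMap (next M))^[N] _ = L
  induction L with
  | nil => simp
  | cons c L ih =>
    rw [List.map_cons, List.sum_cons, ih, List.filter_cons]
    split_ifs <;> simp [add_comm]

/-! ### Primitive recursiveness of the simulation -/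

section Primrec

open Primrec

theorem primrec_read : Primrec FTape.read :=
  option_getD.comp (list_head?.comp .snd) (const 0)

theorem primrec_write : Primrec₂ FTape.write :=
  (Primrec.fst.comp .fst).pair (list_cons.comp .snd (list_tail.comp (Primrec.snd.comp .fst)))

theorem primrec_move : Primrec₂ FTape.move := by
  have h : Primrec fun p : FTape × Move => moveEquiv p.2 := (of_equiv (e := moveEquiv)).comp .snd
  refine (option_casesOn h .fst (g := fun p b =>
    cond b (FTape.read p.1 :: p.1.1, p.1.2.tail) (p.1.1.tail, p.1.1.head?.getD 0 :: p.1.2))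
    (Primrec.cond .snd ?_ ?_)).of_eq fun p => ?_
  · have : Primrec fun p : (FTape × Move) × Bool => p.1.1 := Primrec.fst.comp .fst
    exact (list_cons.comp (primrec_read.comp this) (Primrec.fst.comp this)).pair
      (list_tail.comp (Primrec.snd.comp this))
  · have : Primrec fun p : (FTape × Move) × Bool => p.1.1 := Primrec.fst.comp .fst
    exact (list_tail.comp (Primrec.fst.comp this)).pair (list_cons.comp
      (option_getD.comp (list_head?.comp (Primrec.fst.comp this)) (const 0))
      (Primrec.snd.comp this))
  · rw [FTape.move]; cases moveEquiv p.2 <;> rfl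

theorem primrec_word : Primrec FTape.word := by
  have hp : PrimrecPred fun n : ℕ => n ≠ 0 := (Primrec.eq.comp .id (const 0)).not
  exact (listFilter hp).comp (list_append.comp (list_reverse.comp .fst) .snd)

theorem primrec_tape : Primrec₂ FCfg.tape :=
  option_getD.comp (listLookup.comp .snd (Primrec.snd.comp .fst)) (const _)

theorem primrec_rule : Primrec₂ rule :=
  list_getElem?.comp (Primrec.snd.comp .snd)
    (primrec_read.comp (primrec_tape.comp .fst (Primrec.fst.comp .snd)))

theorem primrec_applyRule : Primrec fun p : FCfg × ℕ × ℕ × Move × ℕ =>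
    applyRule p.1 p.2.1 p.2.2 := by
  have hk : Primrec fun p : FCfg × ℕ × ℕ × Move × ℕ => p.2.1 := Primrec.fst.comp .snd
  have hr : Primrec fun p : FCfg × ℕ × ℕ × Move × ℕ => p.2.2 := Primrec.snd.comp .snd
  refine (Primrec.snd.comp (Primrec.snd.comp hr)).pair (list_cons.comp (hk.pair ?_)
    (Primrec.snd.comp .fst))
  exact primrec_move.comp (primrec_write.comp (primrec_tape.comp .fst hk) (Primrec.fst.comp hr))
    (Primrec.fst.comp (Primrec.snd.comp hr))

theorem primrec_instrEquiv_getElem? : Primrec fun p : OTM × FCfg =>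
    (p.1[p.2.1]?).map instrEquiv :=
  option_map (list_getElem?.comp .fst (Primrec.fst.comp .snd))
    ((of_equiv (e := instrEquiv)).comp .snd)

/-- The coding of instructions is transported along `instrEquiv`, so the case distinction is made on
the corresponding sum type. -/
theorem primrec_next : Primrec₂ next := by
  have hc : Primrec fun p : OTM × FCfg => [p.2, p.2] :=
    list_cons.comp .snd (list_cons.comp .snd (const []))
  have two : ∀ {α : Type} [Primcodable α] {f : α → FCfg}, Primrec f → Primrec fun a => [f a, f a] :=
    fun hf => list_cons.comp hf (list_cons.comp hf (const []))
  have h1 : Primrec₂ fun (p : OTM × FCfg) (i : (ℕ × List (ℕ × Move × ℕ)) ⊕ (ℕ × ℕ) ⊕ (ℕ × ℕ)) =>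
      (i.casesOn (fun r => (rule p.2 r).elim [p.2, p.2] fun a =>
        [applyRule p.2 r.1 a, applyRule p.2 r.1 a])
        fun j => j.casesOn (fun q => [(q.2, p.2.2), (q.1, p.2.2)])
          fun q => [(q.1, p.2.2), (q.1, p.2.2)] : List FCfg) := by
    refine sumCasesOn .snd ?_ (sumCasesOn .snd ?_ ?_)
    · refine (option_casesOn (o := fun q : ((OTM × FCfg) × ((ℕ × List (ℕ × Move × ℕ)) ⊕
          (ℕ × ℕ) ⊕ (ℕ × ℕ))) × (ℕ × List (ℕ × Move × ℕ)) => rule q.1.1.2 q.2)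
        (f := fun q => [q.1.1.2, q.1.1.2])
        (g := fun q a => [applyRule q.1.1.2 q.2.1 a, applyRule q.1.1.2 q.2.1 a])
        (primrec_rule.comp (Primrec.snd.comp (Primrec.fst.comp .fst)) .snd)
        (two (Primrec.snd.comp (Primrec.fst.comp .fst))) (two ?_)).of_eq fun q => ?_
      · exact primrec_applyRule.comp ((Primrec.snd.comp (Primrec.fst.comp (Primrec.fst.comp .fst))).pair
          ((Primrec.fst.comp (Primrec.snd.comp .fst)).pair .snd))
      · beta_reduce
        cases rule q.1.1.2 q.2 <;> rfl
    · have ht : Primrec fun q : (((OTM × FCfg) × ((ℕ × List (ℕ × Move × ℕ)) ⊕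
          (ℕ × ℕ) ⊕ (ℕ × ℕ))) × ((ℕ × ℕ) ⊕ (ℕ × ℕ))) × (ℕ × ℕ) => q.1.1.1.2.2 :=
        Primrec.snd.comp (Primrec.snd.comp (Primrec.fst.comp (Primrec.fst.comp .fst)))
      exact list_cons.comp ((Primrec.snd.comp .snd).pair ht)
        (list_cons.comp ((Primrec.fst.comp .snd).pair ht) (const []))
    · have ht : Primrec fun q : (((OTM × FCfg) × ((ℕ × List (ℕ × Move × ℕ)) ⊕
          (ℕ × ℕ) ⊕ (ℕ × ℕ))) × ((ℕ × ℕ) ⊕ (ℕ × ℕ))) × (ℕ × ℕ) => q.1.1.1.2.2 :=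
        Primrec.snd.comp (Primrec.snd.comp (Primrec.fst.comp (Primrec.fst.comp .fst)))
      exact two ((Primrec.fst.comp .snd).pair ht)
  refine (option_casesOn primrec_instrEquiv_getElem? hc h1).of_eq fun p => ?_
  rw [next]
  rcases p.1[p.2.1]? with _ | ⟨k, r⟩ | ⟨q₀, q₁⟩ | ⟨q₀, q₁⟩ <;> rfl

theorem primrec_halted : Primrec₂ halted := by
  have h1 : Primrec₂ fun (p : OTM × FCfg) (i : (ℕ × List (ℕ × Move × ℕ)) ⊕ (ℕ × ℕ) ⊕ (ℕ × ℕ)) =>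
      (i.casesOn (fun r => !(rule p.2 r).isSome) fun _ => false : Bool) :=
    sumCasesOn .snd (Primrec.not.comp (option_isSome.comp (primrec_rule.comp
      (Primrec.snd.comp (Primrec.fst.comp .fst)) .snd))) (const false)
  refine (option_casesOn primrec_instrEquiv_getElem? (const true) h1).of_eq fun p => ?_
  rw [halted]
  rcases p.1[p.2.1]? with _ | ⟨k, r⟩ | ⟨q₀, q₁⟩ | ⟨q₀, q₁⟩ <;> simp [instrEquiv]

theorem primrec_count : Primrec fun p : OTM × List ℕ × ℕ × ℕ => count p.1 p.2.1 p.2.2.1 p.2.2.2 := by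
  have hL : Primrec fun p : OTM × List ℕ × ℕ × ℕ =>
      (fun L => L.flatMap (next p.1))^[p.2.2.2] [(0, [(0, ([] : List ℕ), p.2.1)])] := by
    refine nat_iterate (Primrec.snd.comp (Primrec.snd.comp .snd)) ?_
      (list_flatMap .snd (primrec_next.comp (Primrec.fst.comp (Primrec.fst.comp .fst)) .snd))
    refine list_cons.comp ((const 0).pair (list_cons.comp ((const 0).pair
      ((const []).pair (Primrec.fst.comp .snd))) (const []))) (const [])
  have hp : PrimrecRel fun (c : FCfg) (p : OTM × List ℕ × ℕ × ℕ) =>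
      (halted p.1 c && decide (FTape.word (FCfg.tape c 1) = [p.2.2.1])) = true := by
    refine Primrec.eq.comp (Primrec.and.comp (primrec_halted.comp (Primrec.fst.comp .snd) .fst)
      (Primrec.eq.decide.comp (primrec_word.comp (primrec_tape.comp .fst (const 1)))
        (list_cons.comp (Primrec.fst.comp (Primrec.snd.comp (Primrec.snd.comp .snd))) (const []))))
      (const true)
  refine (list_length.comp ((hp.listFilter).comp hL .id)).of_eq fun p => ?_
  simp [count]

end Primrec

end OTM.Sim

/-! ## Bracketing real numbers by the answers of an oracle -/

open Filter Topology

/-- Precision `K` tends to infinity, and for each precision sufficiently many answers are known. -/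
def answerFilter (ans : ℕ → unitInterval) : Filter (ℕ × List Bool) :=
  atTop.curry (comap List.length atTop ⊓ 𝓟 {bs | ValidAnswers ans bs})

theorem tendsto_precision (ans : ℕ → unitInterval) :
    Tendsto Prod.fst (answerFilter ans) atTop :=
  tendsto_fst.mono_left curry_le_prod

/-- The number `N` of answers may depend on the precision `K`, as the codes of the queries with
denominator `2 ^ K` do. -/
theorem eventually_answerFilter {ans : ℕ → unitInterval} {p : ℕ × List Bool → Prop} :
    (∀ᶠ s in answerFilter ans, p s) ↔
      ∃ K₀, ∀ K ≥ K₀, ∃ N, ∀ bs, ValidAnswers ans bs → N ≤ bs.length → p (K, bs) := by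
  simp only [answerFilter, eventually_curry_iff, eventually_inf_principal, eventually_comap,
    eventually_atTop, Set.mem_ofPred_eq]
  refine exists_congr fun K₀ => forall₂_congr fun K _ => exists_congr fun N => ?_
  exact ⟨fun h bs hbs hN => h _ hN bs rfl hbs, fun h m hm bs hbs hv => h bs hv (hbs ▸ hm)⟩

theorem eventually_validAnswers (ans : ℕ → unitInterval) :
    ∀ᶠ s in answerFilter ans, ValidAnswers ans s.2 :=
  eventually_answerFilter.2 ⟨0, fun _ _ => ⟨0, fun _ h _ => h⟩⟩

/-- `f false` and `f true` are lower and upper approximations of `x`. -/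
structure Brackets (ans : ℕ → unitInterval) (f : Bool → ℕ × List Bool → ℝ) (x : ℝ) : Prop where
  nonneg : ∀ b s, 0 ≤ f b s
  lower : ∀ s, ValidAnswers ans s.2 → f false s ≤ x
  upper : ∀ s, ValidAnswers ans s.2 → x ≤ f true s
  tendsto : ∀ b, Tendsto (f b) (answerFilter ans) (𝓝 x)

namespace Brackets

variable {ans : ℕ → unitInterval} {f g : Bool → ℕ × List Bool → ℝ} {x y : ℝ}

theorem const (hx : 0 ≤ x) : Brackets ans (fun _ _ => x) x :=
  ⟨fun _ _ => hx, fun _ _ => le_rfl, fun _ _ => le_rfl, fun _ => tendsto_const_nhds⟩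

theorem mul (hf : Brackets ans f x) (hg : Brackets ans g y) :
    Brackets ans (fun b s => f b s * g b s) (x * y) where
  nonneg b s := mul_nonneg (hf.nonneg b s) (hg.nonneg b s)
  lower s hs := mul_le_mul (hf.lower s hs) (hg.lower s hs) (hg.nonneg _ _)
    ((hf.nonneg _ _).trans (hf.lower s hs))
  upper s hs := mul_le_mul (hf.upper s hs) (hg.upper s hs)
    ((hg.nonneg _ _).trans (hg.lower s hs)) (hf.nonneg _ _)
  tendsto b := (hf.tendsto b).mul (hg.tendsto b)

theorem add (hf : Brackets ans f x) (hg : Brackets ans g y) :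
    Brackets ans (fun b s => f b s + g b s) (x + y) where
  nonneg b s := add_nonneg (hf.nonneg b s) (hg.nonneg b s)
  lower s hs := add_le_add (hf.lower s hs) (hg.lower s hs)
  upper s hs := add_le_add (hf.upper s hs) (hg.upper s hs)
  tendsto b := (hf.tendsto b).add (hg.tendsto b)

theorem list_sum {ι : Type*} {F : ι → Bool → ℕ × List Bool → ℝ} {X : ι → ℝ} (l : List ι)
    (h : ∀ i, Brackets ans (F i) (X i)) :
    Brackets ans (fun b s => (l.map fun i => F i b s).sum) (l.map X).sum := by
  induction l with
  | nil => exact const le_rfl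
  | cons i l ih => simpa using (h i).add ih

open Classical in
theorem finset_prod {ι : Type*} {F : ι → Bool → ℕ × List Bool → ℝ} {X : ι → ℝ} (t : Finset ι)
    (h : ∀ i, Brackets ans (F i) (X i)) :
    Brackets ans (fun b s => ∏ i ∈ t, F i b s) (∏ i ∈ t, X i) := by
  induction t using Finset.induction_on with
  | empty => simpa using const zero_le_one
  | insert i t hi ih => simpa only [Finset.prod_insert hi] using (h i).mul ih

end Brackets

/-- A fraction as a real number. -/
noncomputable def fracVal : ℕ × ℕ →* ℝ where
  toFun q := q.1 / q.2
  map_one' := by simp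
  map_mul' q r := by simp [mul_div_mul_comm]

theorem fracVal_apply (q : ℕ × ℕ) : fracVal q = q.1 / q.2 := rfl

theorem fracVal_nonneg (q : ℕ × ℕ) : 0 ≤ fracVal q := div_nonneg q.1.cast_nonneg q.2.cast_nonneg

open Classical in
/-- Lower or upper approximation with denominator `2 ^ K` of a probability, given lower
approximations `lo` for all outcomes. -/
noncomputable def distApprox {Y : Type*} [Fintype Y] (lo : Y → ℕ) (K : ℕ) (b : Bool) (y : Y) :
    ℕ × ℕ :=
  (cond b (2 ^ K - ∑ z, if z = y then 0 else lo z) (lo y), 2 ^ K)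

-- Lower bounds suffice: the values of `f` sum to one, so subtracting lower bounds for all other
-- outcomes from `1` bounds `f y` from above, and the limits agree.
open Classical in
theorem brackets_distApprox {ans : ℕ → unitInterval} {Y : Type*} [Fintype Y]
    {lo : ℕ × List Bool → Y → ℕ} {f : Y → ℝ} (hf : ∑ y, f y = 1)
    (hle : ∀ y s, ValidAnswers ans s.2 → (lo s y : ℝ) / 2 ^ s.1 ≤ f y)
    (hlim : ∀ y, Tendsto (fun s => (lo s y : ℝ) / 2 ^ s.1) (answerFilter ans) (𝓝 (f y))) (y : Y) :
    Brackets ans (fun b s => fracVal (distApprox (lo s) s.1 b y)) (f y) := by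
  have hf' : 1 - ∑ z, (if z = y then 0 else f z) = f y := by
    rw [← hf, ← Finset.sum_sub_distrib, Finset.sum_eq_single y] <;> simp +contextual
  have hle' : ∀ s, ValidAnswers ans s.2 →
      (∑ z, (if z = y then 0 else (lo s z : ℝ) / 2 ^ s.1)) ≤ ∑ z, if z = y then 0 else f z :=
    fun s hs => Finset.sum_le_sum fun z _ => by split_ifs; exacts [le_rfl, hle z s hs]
  have hup : ∀ s, ValidAnswers ans s.2 → fracVal (distApprox (lo s) s.1 true y) =
      1 - ∑ z, if z = y then 0 else (lo s z : ℝ) / 2 ^ s.1 := by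
    intro s hs
    have hsum : (∑ z, if z = y then 0 else (lo s z : ℝ) / 2 ^ s.1) =
        ((∑ z, if z = y then 0 else lo s z : ℕ) : ℝ) / 2 ^ s.1 := by
      rw [Nat.cast_sum, Finset.sum_div]
      exact Finset.sum_congr rfl fun z _ => by split_ifs <;> simp
    have hpos : (0 : ℝ) < 2 ^ s.1 := by positivity
    have hnn : 0 ≤ f y :=
      (div_nonneg (Nat.cast_nonneg _) hpos.le).trans (hle y s hs)
    have h1 := hle' s hs
    rw [hsum, div_le_iff₀ hpos] at h1
    -- The subtraction of natural numbers in `distApprox` is not truncated on valid answers, because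
    -- the other outcomes have total probability `1 - f y ≤ 1`.
    have h2 : (∑ z, if z = y then 0 else lo s z) ≤ 2 ^ s.1 := by
      have : ((∑ z, if z = y then 0 else lo s z : ℕ) : ℝ) ≤ 2 ^ s.1 :=
        h1.trans (mul_le_of_le_one_left hpos.le (by linarith))
      exact_mod_cast this
    rw [hsum, fracVal_apply, distApprox, cond_true, Nat.cast_sub h2]
    push_cast
    rw [sub_div, div_self hpos.ne']
  refine ⟨fun b s => fracVal_nonneg _, fun s hs => ?_, fun s hs => ?_, ?_⟩
  · simpa [fracVal_apply, distApprox] using hle y s hs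
  · rw [hup s hs, ← hf']
    exact sub_le_sub_left (hle' s hs) 1
  · rintro (_ | _)
    · simpa [fracVal_apply, distApprox] using hlim y
    · rw [← hf']
      refine Tendsto.congr' ((eventually_validAnswers ans).mono fun s hs => (hup s hs).symm) ?_
      refine tendsto_const_nhds.sub (tendsto_finsetSum _ fun z _ => ?_)
      split_ifs
      · exact tendsto_const_nhds
      · exact hlim z

/-! ### Strategies -/

section Strategy

variable {A E : Type*} [Primcodable A] [Primcodable E]

/-- The number of positive multiples of `2 ^ (-K)` that the oracle is known to put below the
probability of the action `a`. -/
def stratCount (T : OTM) (x : List (A ⊕ E)) (a : A) (s : ℕ × List Bool) : ℕ :=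
  ((List.range (2 ^ s.1)).filter fun j =>
    s.2[Encodable.encode (T, x, (j + 1, 2 ^ s.1), a)]? = some true).length

theorem ans_encode (O : Oracle A E) (T : OTM) (x : List (A ⊕ E)) (a : A) (j K : ℕ)
    (h : ((j : ℚ) / (2 ^ K : ℕ)) ∈ Set.Icc (0 : ℚ) 1) :
    O.ans (Encodable.encode (T, x, (j, 2 ^ K), a)) = O T x ⟨_, h⟩ a := by
  simp only [Oracle.ans, Encodable.encodek]
  exact dif_pos h

variable [Fintype A] {O : Oracle A E} {T : OTM} {π : Strategy A E}

/-- The output probabilities on this history sum to one, so the lower and upper limits for `q a`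
coincide and `q a = π h a`. -/
theorem OTM.GeneratesStrategy.oracle_eq (hO : O.Reflective) (hT : T.GeneratesStrategy O π)
    (h : List (A × E)) (a : A) (p : Set.Icc (0 : ℚ) 1) :
    (((p : ℚ) : ℝ) < π h a → O T (flat h) p a = 1) ∧
      (π h a < ((p : ℚ) : ℝ) → O T (flat h) p a = 0) := by
  classical
  obtain ⟨q, -, hq⟩ := hO T (flat h)
  obtain ⟨h1, h2, h3⟩ := hq a
  have hsum : ∑ b, (π h) b = 1 := (π h).2.2
  rw [← Finset.sum_filter_add_sum_filter_not _ (fun b => b ≠ a)] at hsum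
  have hs : ∑ b with ¬ b ≠ a, (π h) b = π h a := by
    simp [Finset.sum_filter]
  have hl : ∑ β with β ≠ a, T.lam O.ans (flat h) (.inl β) = ∑ β with β ≠ a, (π h) β :=
    Finset.sum_congr rfl fun b _ => (hT h b).symm
  have hqa : q a = π h a := by
    rw [← hT h a] at h1
    have h2' : q a ≤ 1 - ∑ β with β ≠ a, (π h) β := by
      rw [← hl]; convert h2
    linarith
  rw [← hqa]
  exact h3 p

theorem mem_unit_grid {j K : ℕ} (hj : j ≤ 2 ^ K) : ((j : ℚ) / (2 ^ K : ℕ)) ∈ Set.Icc (0 : ℚ) 1 :=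
  ⟨by positivity, div_le_one_of_le₀ (by exact_mod_cast hj) (by positivity)⟩

/-- In a valid sequence the answer `1` at `p` has positive probability, which excludes `p > π h a`.
Hence every counted grid point is at most `π h a`, whatever a random answer at `p = π h a` was. -/
theorem stratCount_le (hO : O.Reflective) (hT : T.GeneratesStrategy O π) (h : List (A × E))
    (a : A) (s : ℕ × List Bool) (hs : ValidAnswers O.ans s.2) :
    (stratCount T (flat h) a s : ℝ) / 2 ^ s.1 ≤ π h a := by
  obtain ⟨K, bs⟩ := s
  have hpos : (0 : ℝ) < 2 ^ K := by positivity
  rw [div_le_iff₀ hpos]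
  have hnn : 0 ≤ π h a * 2 ^ K := mul_nonneg ((π h).2.1 a) hpos.le
  refine (Nat.cast_le.2 ?_).trans (Nat.floor_le hnn)
  rw [← List.length_range (n := ⌊π h a * 2 ^ K⌋₊)]
  refine List.Subperm.length_le ((List.nodup_range.filter _).subperm fun j hj => ?_)
  simp only [List.mem_filter, List.mem_range, decide_eq_true_eq] at hj ⊢
  have hgrid := mem_unit_grid (Nat.succ_le_of_lt hj.1)
  have h0 := (hs _ _ hj.2).1 rfl
  rw [ans_encode O T (flat h) a (j + 1) K hgrid] at h0
  have h1 := not_lt.1 fun hlt => h0 ((hT.oracle_eq hO h a ⟨_, hgrid⟩).2 hlt)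
  push_cast at h1
  rw [div_le_iff₀ hpos] at h1
  exact Nat.lt_of_succ_le (Nat.le_floor (by push_cast; exact h1))

/-- Grid points strictly below `π h a` are answered by `1` with certainty, so each is counted once
its query has been asked. -/
theorem le_stratCount (hO : O.Reflective) (hT : T.GeneratesStrategy O π) (h : List (A × E))
    (a : A) (K : ℕ) : ∃ N, ∀ bs, ValidAnswers O.ans bs → N ≤ bs.length →
      π h a - 1 / 2 ^ K ≤ (stratCount T (flat h) a (K, bs) : ℝ) / 2 ^ K := by
  have hpos : (0 : ℝ) < 2 ^ K := by positivity
  -- The bound exceeds the numbers of all queries of precision `K`, so a list of this length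
  -- contains their answers.
  refine ⟨(Finset.range (2 ^ K)).sup (fun j =>
    Encodable.encode (T, flat h, (j + 1, 2 ^ K), a)) + 1, fun bs hbs hN => ?_⟩
  rw [le_div_iff₀ hpos, sub_mul, one_div_mul_cancel hpos.ne']
  have hle : π h a ≤ 1 := by
    have := (π h).2.2
    rw [← this]
    exact Finset.single_le_sum (fun b _ => (π h).2.1 b) (Finset.mem_univ a)
  -- There are `⌈π h a * 2 ^ K⌉₊ - 1` positive multiples of the mesh strictly below `π h a`; a
  -- multiple equal to `π h a` is not guaranteed to be counted.
  suffices H : ⌈π h a * 2 ^ K⌉₊ - 1 ≤ stratCount T (flat h) a (K, bs) by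
    have h1 := Nat.le_ceil (π h a * 2 ^ K)
    have h2 : (⌈π h a * 2 ^ K⌉₊ : ℝ) ≤ stratCount T (flat h) a (K, bs) + 1 := by
      exact_mod_cast Nat.sub_le_iff_le_add.1 H
    linarith
  rw [← List.length_range (n := ⌈π h a * 2 ^ K⌉₊ - 1)]
  refine List.Subperm.length_le (List.nodup_range.subperm fun j hj => ?_)
  simp only [List.mem_filter, List.mem_range, decide_eq_true_eq] at hj ⊢
  have hj1 : ((j + 1 : ℕ) : ℝ) < π h a * 2 ^ K := Nat.lt_ceil.1 (by omega)
  have hjK : j + 1 ≤ 2 ^ K := by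
    have : ((j + 1 : ℕ) : ℝ) ≤ 2 ^ K := hj1.le.trans (mul_le_of_le_one_left hpos.le hle)
    exact_mod_cast this
  have hlen : Encodable.encode (T, flat h, (j + 1, 2 ^ K), a) < bs.length :=
    lt_of_lt_of_le (Nat.lt_succ_of_le (Finset.le_sup (f := fun j =>
      Encodable.encode (T, flat h, (j + 1, 2 ^ K), a)) (Finset.mem_range.2 hjK))) hN
  refine ⟨hjK, ?_⟩
  have hgrid := mem_unit_grid hjK
  have h1 : O.ans (Encodable.encode (T, flat h, (j + 1, 2 ^ K), a)) = 1 := by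
    rw [ans_encode O T (flat h) a (j + 1) K hgrid]
    refine (hT.oracle_eq hO h a ⟨_, hgrid⟩).1 ?_
    push_cast at hj1 ⊢
    rwa [div_lt_iff₀ hpos]
  have hv := hbs _ _ (List.getElem?_eq_getElem hlen)
  rw [List.getElem?_eq_getElem hlen]
  rcases hb : bs[Encodable.encode (T, flat h, (j + 1, 2 ^ K), a)] with _ | _
  · exact absurd h1 (hv.2 hb)
  · rfl

theorem tendsto_stratCount (hO : O.Reflective) (hT : T.GeneratesStrategy O π) (h : List (A × E))
    (a : A) : Tendsto (fun s => (stratCount T (flat h) a s : ℝ) / 2 ^ s.1)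
      (answerFilter O.ans) (𝓝 (π h a)) := by
  have hlim : Tendsto (fun K : ℕ => π h a - 1 / 2 ^ K) atTop (𝓝 (π h a)) := by
    have := tendsto_pow_atTop_nhds_zero_of_lt_one (r := (1 / 2 : ℝ)) (by norm_num) (by norm_num)
    simpa using tendsto_const_nhds (x := π h a).sub this
  refine tendsto_of_tendsto_of_tendsto_of_le_of_le' (hlim.comp (tendsto_precision _))
    tendsto_const_nhds ?_ ((eventually_validAnswers _).mono fun s hs => stratCount_le hO hT h a s hs)
  exact eventually_answerFilter.2 ⟨0, fun K _ => le_stratCount hO hT h a K⟩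

end Strategy

/-! ### Games -/

section Game

variable {n : ℕ} {A E : Type*} [Fintype E] [Primcodable A] [Primcodable E]
  {T : OTM} {σ : Game n A E}

/-- The number of coin sequences of length `K` for which `T` generates the percept `e`. -/
def gameCount (T : OTM) (x : List ((Fin n → A) ⊕ (Fin n → E))) (e : Fin n → E) (K : ℕ) : ℕ :=
  OTM.Sim.count T (x.map sym) (sym (Sum.inr e : (Fin n → A) ⊕ (Fin n → E))) K

theorem gameCount_le (hT : T.GeneratesGame σ) (h : List ((Fin n → A) × (Fin n → E)))
    (a : Fin n → A) (e : Fin n → E) (K : ℕ) :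
    (gameCount T (flat h ++ [.inl a]) e K : ℝ) / 2 ^ K ≤ σ h a e := by
  rw [hT.2, gameCount, ← OTM.Sim.haltProb_eq_count]
  exact OTM.haltProb_le_prob _ _

theorem tendsto_gameCount (hT : T.GeneratesGame σ) (h : List ((Fin n → A) × (Fin n → E)))
    (a : Fin n → A) (e : Fin n → E) :
    Tendsto (fun K => (gameCount T (flat h ++ [.inl a]) e K : ℝ) / 2 ^ K) atTop
      (𝓝 (σ h a e)) := by
  simp only [gameCount, ← OTM.Sim.haltProb_eq_count, hT.2 h a e]
  exact OTM.tendsto_haltProb _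

end Game

/-! ## Approximation of history distributions -/

/-- Induction one symbol at a time, matching the recursive equations of the history distribution. -/
theorem Hist.induction {X Y : Type*} {p : Hist X Y → Prop} (nil : p ([], none))
    (act : ∀ h a, p (h, none) → p (h, some a))
    (per : ∀ h a e, p (h, some a) → p (h ++ [(a, e)], none)) (x : Hist X Y) : p x := by
  have key : ∀ h, p (h, none) := fun h => by
    induction h using List.reverseRecOn with
    | nil => exact nil
    | append_singleton h z ih => exact per h z.1 z.2 (act h z.1 ih)
  rcases x with ⟨h, _ | a⟩
  exacts [key h, act h a (key h)]

section Weight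

variable {X Y R R' : Type*} [CommMonoid R] [CommMonoid R']

/-- The product of the factors contributed by the actions and percepts of a history. -/
def histWeight (act : List (X × Y) → X → R) (per : List (X × Y) → X → Y → R) (x : Hist X Y) : R :=
  (x.1.foldl (fun s z => (s.1 ++ [z], s.2 * act s.1 z.1 * per s.1 z.1 z.2)) ([], 1)).2 *
    x.2.elim 1 (act x.1)

variable (act : List (X × Y) → X → R) (per : List (X × Y) → X → Y → R)

theorem histWeight_nil : histWeight act per ([], none) = 1 := by simp [histWeight]

theorem histWeight_action (h : List (X × Y)) (a : X) :
    histWeight act per (h, some a) = histWeight act per (h, none) * act h a := by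
  simp [histWeight]

theorem histWeight_percept (h : List (X × Y)) (a : X) (e : Y) :
    histWeight act per (h ++ [(a, e)], none) = histWeight act per (h, some a) * per h a e := by
  -- The first component of the fold is the prefix read so far, on which the next factors depend.
  have : ∀ h : List (X × Y), (h.foldl (fun s z => (s.1 ++ [z], s.2 * act s.1 z.1 *
      per s.1 z.1 z.2)) (([] : List (X × Y)), (1 : R))).1 = h := fun h => by
    induction h using List.reverseRecOn with
    | nil => rfl
    | append_singleton h z ih => simp [List.foldl_append, ih]
  simp [histWeight, List.foldl_append, this]

variable {act per}

/-- Applied to `fracVal`, this relates the computed product of fractions to the product of their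
real values. -/
theorem map_histWeight (φ : R →* R') (x : Hist X Y) : φ (histWeight act per x) =
    histWeight (fun h a => φ (act h a)) (fun h a e => φ (per h a e)) x := by
  induction x using Hist.induction with
  | nil => simp [histWeight_nil]
  | act h a ih => rw [histWeight_action, histWeight_action, map_mul, ih]
  | per h a e ih => rw [histWeight_percept, histWeight_percept, map_mul, ih]

theorem histWeight_closed {p : R → Prop} (h1 : p 1) (hm : ∀ r s, p r → p s → p (r * s))
    (ha : ∀ h a, p (act h a)) (hp : ∀ h a e, p (per h a e)) (x : Hist X Y) :
    p (histWeight act per x) := by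
  induction x using Hist.induction with
  | nil => rwa [histWeight_nil]
  | act h a ih => rw [histWeight_action]; exact hm _ _ ih (ha h a)
  | per h a e ih => rw [histWeight_percept]; exact hm _ _ ih (hp h a e)

theorem Brackets.histWeight {ans : ℕ → unitInterval}
    {act : Bool → ℕ × List Bool → List (X × Y) → X → ℝ}
    {per : Bool → ℕ × List Bool → List (X × Y) → X → Y → ℝ}
    {act' : List (X × Y) → X → ℝ} {per' : List (X × Y) → X → Y → ℝ}
    (ha : ∀ h a, Brackets ans (fun b s => act b s h a) (act' h a))
    (hp : ∀ h a e, Brackets ans (fun b s => per b s h a e) (per' h a e)) (x : Hist X Y) :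
    Brackets ans (fun b s => _root_.histWeight (act b s) (per b s) x)
      (_root_.histWeight act' per' x) := by
  induction x using Hist.induction with
  | nil => simpa only [histWeight_nil] using Brackets.const zero_le_one
  | act h a ih => simpa only [histWeight_action] using ih.mul (ha h a)
  | per h a e ih => simpa only [histWeight_percept] using ih.mul (hp h a e)

end Weight

/-! ### Arithmetic of fractions and certified quotients -/

/-- The sum of a list of fractions. -/
def fracSum (l : List (ℕ × ℕ)) : ℕ × ℕ :=
  l.foldr (fun q s => (q.1 * s.2 + s.1 * q.2, q.2 * s.2)) (0, 1)

theorem fracSum_spec (l : List (ℕ × ℕ)) (h : ∀ q ∈ l, q.2 ≠ 0) :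
    (fracSum l).2 ≠ 0 ∧ fracVal (fracSum l) = (l.map fracVal).sum := by
  induction l with
  | nil => simp [fracSum, fracVal_apply]
  | cons q l ih =>
    obtain ⟨h1, h2⟩ := ih fun r hr => h r (List.mem_cons_of_mem _ hr)
    have hq := h q List.mem_cons_self
    refine ⟨mul_ne_zero hq h1, ?_⟩
    rw [List.map_cons, List.sum_cons, ← h2]
    change fracVal (q.1 * (fracSum l).2 + (fracSum l).1 * q.2, q.2 * (fracSum l).2) = _
    have hq' : (q.2 : ℝ) ≠ 0 := by exact_mod_cast hq
    have h1' : ((fracSum l).2 : ℝ) ≠ 0 := by exact_mod_cast h1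
    simp only [fracVal_apply]
    push_cast
    field_simp

/-- Given lower and upper bounds for numerator and denominator of a quotient, a fraction for the
quotient if these bounds determine it up to an error less than `1 / k`. -/
def quotApprox (nl nh dl dh : ℕ × ℕ) (k : ℕ) : Option (ℕ × ℕ) :=
  if nl.2 * dh.1 ≠ 0 ∧ nh.2 * dl.1 ≠ 0 ∧
    k * (nh.1 * dl.2) * (nl.2 * dh.1) <
      k * (nl.1 * dh.2) * (nh.2 * dl.1) + (nh.2 * dl.1) * (nl.2 * dh.1)
  then some (nl.1 * dh.2, nl.2 * dh.1) else none

theorem fracVal_quot (q r : ℕ × ℕ) : fracVal (q.1 * r.2, q.2 * r.1) = fracVal q / fracVal r := by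
  simp only [fracVal_apply]
  push_cast
  rw [div_div_div_eq]

/-- Clearing denominators makes the stopping test a comparison of natural numbers. -/
theorem quot_lt_iff {u l : ℕ × ℕ} {k : ℕ} (hk : 0 < k) (hu : u.2 ≠ 0) (hl : l.2 ≠ 0) :
    k * u.1 * l.2 < k * l.1 * u.2 + u.2 * l.2 ↔ fracVal u < fracVal l + 1 / k := by
  have hk' : (0 : ℝ) < k := by exact_mod_cast hk
  have hu' : (0 : ℝ) < u.2 := by exact_mod_cast Nat.pos_of_ne_zero hu
  have hl' : (0 : ℝ) < l.2 := by exact_mod_cast Nat.pos_of_ne_zero hl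
  rw [fracVal_apply, fracVal_apply, div_add_div _ _ hl'.ne' hk'.ne', div_lt_div_iff₀ hu' (by positivity),
    ← Nat.cast_lt (α := ℝ)]
  push_cast
  constructor <;> intro h <;> linarith

/-- The quotient `N / D` lies between the values of `nl / dh` and `nh / dl`. The test says that
these differ by less than `1 / k`, and the lower one is returned. -/
theorem quotApprox_spec {nl nh dl dh r : ℕ × ℕ} {k : ℕ} (hk : 0 < k)
    (h : quotApprox nl nh dl dh k = some r) {N D : ℝ} (hN : fracVal nl ≤ N) (hN' : N ≤ fracVal nh)
    (hD : fracVal dl ≤ D) (hD' : D ≤ fracVal dh) (h0 : 0 < D) (hdl : dl.2 ≠ 0) :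
    r.2 ≠ 0 ∧ |N / D - (r.1 : ℝ) / r.2| < 1 / k := by
  unfold quotApprox at h
  split_ifs at h with hc
  obtain ⟨h1, h2, h3⟩ := hc
  cases h
  refine ⟨h1, ?_⟩
  have h4 := (quot_lt_iff (u := (nh.1 * dl.2, nh.2 * dl.1)) (l := (nl.1 * dh.2, nl.2 * dh.1))
    hk h2 h1).1 h3
  have h5 := fracVal_quot nl dh
  rw [fracVal_quot, fracVal_quot] at h4
  rw [fracVal_apply] at h5
  rw [h5]
  have hdl0 : 0 < fracVal dl := by
    rw [fracVal_apply]
    have := Nat.pos_of_ne_zero (right_ne_zero_of_mul h2)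
    have := Nat.pos_of_ne_zero hdl
    positivity
  have hlow : fracVal nl / fracVal dh ≤ N / D :=
    div_le_div₀ ((fracVal_nonneg _).trans hN) hN h0 hD'
  have hupp : N / D ≤ fracVal nh / fracVal dl :=
    div_le_div₀ (fracVal_nonneg _) hN' hdl0 hD
  rw [abs_of_nonneg (sub_nonneg.2 hlow)]
  linarith

theorem quotApprox_isSome {nl nh dl dh : ℕ × ℕ} {k : ℕ} (hk : 0 < k) (hnl : nl.2 ≠ 0)
    (hnh : nh.2 ≠ 0) (hdl : 0 < fracVal dl) (hdh : 0 < fracVal dh)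
    (h : fracVal nh / fracVal dl < fracVal nl / fracVal dh + 1 / k) :
    (quotApprox nl nh dl dh k).isSome := by
  have key : ∀ {q : ℕ × ℕ}, 0 < fracVal q → q.1 ≠ 0 := fun hq h0 => by
    rw [fracVal_apply, h0] at hq
    simp at hq
  have h1 := mul_ne_zero hnl (key hdh)
  have h2 := mul_ne_zero hnh (key hdl)
  rw [quotApprox, if_pos]
  · rfl
  · refine ⟨h1, h2, ?_⟩
    rw [← fracVal_quot, ← fracVal_quot] at h
    exact (quot_lt_iff (u := (nh.1 * dl.2, nh.2 * dl.1)) (l := (nl.1 * dh.2, nl.2 * dh.1))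
      hk h2 h1).2 h

section Approx

variable {n : ℕ} {A E : Type*} [Fintype A] [Fintype E]

/-- The history distribution without the factors of the player that is left out. -/
noncomputable def partialDist (σ : Game n A E) (π : Fin n → Strategy A E) (o : Option (Fin n)) :
    Hist (Fin n → A) (Fin n → E) → ℝ :=
  histWeight (fun h a => ∏ j, if o = some j then 1 else π j (proj j h) (a j))
    (fun h a e => σ h a e)

theorem partialDist_none (σ : Game n A E) (π : Fin n → Strategy A E)
    (x : Hist (Fin n → A) (Fin n → E)) : partialDist σ π none x = histDist σ π x := by
  unfold partialDist
  induction x using Hist.induction with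
  | nil => rw [histWeight_nil, histDist_nil]
  | act h a ih => rw [histWeight_action, histDist_action, ih]; simp [actProb]
  | per h a e ih => rw [histWeight_percept, histDist_percept, ih]

variable [Primcodable A] [Primcodable E]

/-- The machines of the game and of the players, a player to be left out, a direction of
approximation, a precision, and answers of the oracle. -/
abbrev Context (n : ℕ) := ((OTM × (Fin n → OTM)) × Option (Fin n)) × Bool × ℕ × List Bool

open Classical in
/-- Approximation of the probability that the players choose `a`, without the factor of the
player that is left out. -/
noncomputable def actApprox (c : Context n) (h : List ((Fin n → A) × (Fin n → E)))
    (a : Fin n → A) : ℕ × ℕ :=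
  ∏ j, if c.1.2 = some j then 1 else
    distApprox (fun a' => stratCount (c.1.1.2 j) (flat (proj j h)) a' c.2.2) c.2.2.1 c.2.1 (a j)

noncomputable def perApprox (c : Context n) (h : List ((Fin n → A) × (Fin n → E)))
    (a : Fin n → A) (e : Fin n → E) : ℕ × ℕ :=
  distApprox (fun e' => gameCount c.1.1.1 (flat h ++ [.inl a]) e' c.2.2.1) c.2.2.1 c.2.1 e

noncomputable def sumApprox (c : Context n) (l : List (Hist (Fin n → A) (Fin n → E))) : ℕ × ℕ :=
  fracSum (l.map (histWeight (actApprox c) (perApprox c)))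

variable {O : Oracle A E} {σ : Game n A E} {π : Fin n → Strategy A E} {Tσ : OTM}
  {T : Fin n → OTM}

theorem brackets_actApprox {B : Type*} [Primcodable B] {O : Oracle A B}
    {π : Fin n → Strategy A B} (hO : O.Reflective) (hT : ∀ j, (T j).GeneratesStrategy O (π j))
    (o : Option (Fin n)) (h : List ((Fin n → A) × (Fin n → B))) (a : Fin n → A) :
    Brackets O.ans (fun b s => fracVal (actApprox (((Tσ, T), o), b, s) h a))
      (∏ j, if o = some j then 1 else π j (proj j h) (a j)) := by
  simp only [actApprox, map_prod]
  refine Brackets.finset_prod _ fun j => ?_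
  by_cases ho : o = some j
  · simpa [ho] using Brackets.const zero_le_one
  · simp only [if_neg ho]
    exact brackets_distApprox (lo := fun s a' => stratCount (T j) (flat (proj j h)) a' s)
      (π j (proj j h)).2.2 (fun a' s hs => stratCount_le hO (hT j) _ a' s hs)
      (fun a' => tendsto_stratCount hO (hT j) _ a') (a j)

theorem brackets_perApprox {B : Type*} [Primcodable B] {ans : ℕ → unitInterval}
    {σ : Game n B E} (hσ : Tσ.GeneratesGame σ) (o : Option (Fin n))
    (h : List ((Fin n → B) × (Fin n → E))) (a : Fin n → B) (e : Fin n → E) :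
    Brackets ans (fun b s => fracVal (perApprox (((Tσ, T), o), b, s) h a e)) (σ h a e) := by
  have h1 : ∀ e' (s : ℕ × List Bool), ValidAnswers ans s.2 →
      (gameCount Tσ (flat h ++ [.inl a]) e' s.1 : ℝ) / 2 ^ s.1 ≤ σ h a e' :=
    fun e' s _ => gameCount_le hσ h a e' s.1
  have h2 : ∀ e', Tendsto (fun s : ℕ × List Bool =>
      (gameCount Tσ (flat h ++ [.inl a]) e' s.1 : ℝ) / 2 ^ s.1) (answerFilter ans)
      (𝓝 (σ h a e')) :=
    fun e' => (tendsto_gameCount hσ h a e').comp (tendsto_precision ans)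
  have hsum : ∑ e', σ h a e' = 1 := (σ h a).2.2
  generalize hlo : (fun (s : ℕ × List Bool) e' => gameCount Tσ (flat h ++ [Sum.inl a]) e' s.1) = lo
  have h1' : ∀ e' (s : ℕ × List Bool), ValidAnswers ans s.2 →
      (lo s e' : ℝ) / 2 ^ s.1 ≤ σ h a e' := hlo ▸ h1
  have h2' : ∀ e', Tendsto (fun s : ℕ × List Bool => (lo s e' : ℝ) / 2 ^ s.1) (answerFilter ans)
      (𝓝 (σ h a e')) := hlo ▸ h2
  have h3 := brackets_distApprox (lo := lo) (f := fun e' => σ h a e') hsum h1' h2' e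
  rw [← hlo] at h3
  exact h3

theorem sumApprox_spec (c : Context n) (l : List (Hist (Fin n → A) (Fin n → E))) :
    (sumApprox c l).2 ≠ 0 ∧ fracVal (sumApprox c l) = (l.map (histWeight
      (fun h a => fracVal (actApprox c h a)) fun h a e => fracVal (perApprox c h a e))).sum := by
  have key : ∀ x : Hist (Fin n → A) (Fin n → E),
      (histWeight (actApprox c) (perApprox c) x).2 ≠ 0 := fun x => by
    refine histWeight_closed (p := fun q : ℕ × ℕ => q.2 ≠ 0) (by simp)
      (fun r s hr hs => mul_ne_zero hr hs) (fun h a => ?_) (fun h a e => ?_) x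
    · refine Finset.prod_induction _ (fun q : ℕ × ℕ => q.2 ≠ 0)
        (fun r s hr hs => mul_ne_zero hr hs) (by simp) fun j _ => ?_
      split_ifs <;> simp [distApprox]
    · simp [perApprox, distApprox]
  obtain ⟨h1, h2⟩ := fracSum_spec (l.map (histWeight (actApprox c) (perApprox c))) (by
    intro q hq
    obtain ⟨x, -, rfl⟩ := List.mem_map.1 hq
    exact key x)
  refine ⟨h1, h2.trans ?_⟩
  rw [List.map_map]
  congr 1
  exact List.map_congr_left fun x _ => map_histWeight fracVal x

theorem brackets_sumApprox (hO : O.Reflective) (hσ : Tσ.GeneratesGame σ)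
    (hT : ∀ j, (T j).GeneratesStrategy O (π j)) (o : Option (Fin n))
    (l : List (Hist (Fin n → A) (Fin n → E))) :
    Brackets O.ans (fun b s => fracVal (sumApprox (((Tσ, T), o), b, s) l))
      (l.map (partialDist σ π o)).sum := by
  simp only [(sumApprox_spec _ _).2]
  exact Brackets.list_sum l fun x => Brackets.histWeight
    (act := fun b s h a => fracVal (actApprox (((Tσ, T), o), b, s) h a))
    (per := fun b s h a e => fracVal (perApprox (((Tσ, T), o), b, s) h a e))
    (brackets_actApprox hO hT o) (brackets_perApprox hσ o) x

/-! ### The approximations are primitive recursive -/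

open Primrec

variable {α : Type*} [Primcodable α]

theorem primrec_flat {X Y : Type*} [Primcodable X] [Primcodable Y] : Primrec (@flat X Y) :=
  list_flatMap .id (list_cons.comp (sumInl.comp (Primrec.fst.comp .snd))
    (list_cons.comp (sumInr.comp (Primrec.snd.comp .snd)) (.const [])))

theorem primrec_proj {X Y : Type*} [Primcodable X] [Primcodable Y] : Primrec₂ (@proj n X Y) :=
  list_map .snd ((fin_app.comp (Primrec.fst.comp .snd) (Primrec.fst.comp .fst)).pair
    (fin_app.comp (Primrec.snd.comp .snd) (Primrec.fst.comp .fst)))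

theorem primrec_nat_pow : Primrec₂ ((· ^ ·) : ℕ → ℕ → ℕ) := Primrec₂.unpaired'.1 Nat.Primrec.pow

theorem primrec_frac_mul : Primrec₂ ((· * ·) : ℕ × ℕ → ℕ × ℕ → ℕ × ℕ) :=
  (nat_mul.comp (Primrec.fst.comp .fst) (Primrec.fst.comp .snd)).pair
    (nat_mul.comp (Primrec.snd.comp .fst) (Primrec.snd.comp .snd))

-- The index set is fixed, so the sum is a composition of a fixed number of additions.
open Classical in
theorem primrec_finset_sum {ι : Type*} {f : ι → α → ℕ} (hf : ∀ i, Primrec (f i)) (t : Finset ι) :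
    Primrec fun x => ∑ i ∈ t, f i x := by
  induction t using Finset.induction_on with
  | empty => simpa using Primrec.const 0
  | insert i t hi ih => simpa only [Finset.sum_insert hi] using nat_add.comp (hf i) ih

open Classical in
theorem primrec_finset_prod {ι : Type*} {f : ι → α → ℕ × ℕ} (hf : ∀ i, Primrec (f i))
    (t : Finset ι) : Primrec fun x => ∏ i ∈ t, f i x := by
  induction t using Finset.induction_on with
  | empty => simpa using Primrec.const (1 : ℕ × ℕ)
  | insert i t hi ih => simpa only [Finset.prod_insert hi] using primrec_frac_mul.comp (hf i) ih

open Classical in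
theorem primrec_distApprox {Y : Type*} [Primcodable Y] [Fintype Y]
    {lo : α → Y → ℕ} {K : α → ℕ} {b : α → Bool} {y : α → Y} (hlo : Primrec₂ lo) (hK : Primrec K)
    (hb : Primrec b) (hy : Primrec y) : Primrec fun x => distApprox (lo x) (K x) (b x) (y x) := by
  have h2 : Primrec fun x => 2 ^ K x := primrec_nat_pow.comp (.const 2) hK
  refine (Primrec.cond hb (nat_sub.comp h2 (primrec_finset_sum (fun z => ?_) _))
    (hlo.comp .id hy)).pair h2
  exact Primrec.ite (Primrec.eq.comp (.const z) hy) (.const 0) (hlo.comp .id (.const z))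

theorem primrec_stratCount {X Y : Type*} [Primcodable X] [Primcodable Y] :
    Primrec fun q : OTM × List (X ⊕ Y) × X × ℕ × List Bool =>
      stratCount q.1 q.2.1 q.2.2.1 q.2.2.2 := by
  have hs : Primrec fun q : OTM × List (X ⊕ Y) × X × ℕ × List Bool => q.2.2.2 :=
    Primrec.snd.comp (Primrec.snd.comp .snd)
  have h2 : Primrec fun q : OTM × List (X ⊕ Y) × X × ℕ × List Bool => 2 ^ q.2.2.2.1 :=
    primrec_nat_pow.comp (.const 2) (Primrec.fst.comp hs)
  have hp : PrimrecRel fun (j : ℕ) (q : OTM × List (X ⊕ Y) × X × ℕ × List Bool) =>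
      q.2.2.2.2[Encodable.encode (q.1, q.2.1, (j + 1, 2 ^ q.2.2.2.1), q.2.2.1)]? = some true := by
    refine Primrec.eq.comp (list_getElem?.comp (Primrec.snd.comp (hs.comp .snd))
      (Primrec.encode.comp ?_)) (.const _)
    exact (Primrec.fst.comp .snd).pair ((Primrec.fst.comp (Primrec.snd.comp .snd)).pair
      (((Primrec.succ.comp .fst).pair (h2.comp .snd)).pair
        (Primrec.fst.comp (Primrec.snd.comp (Primrec.snd.comp .snd)))))
  exact (list_length.comp (hp.listFilter.comp (list_range.comp h2) .id)).of_eq fun q => rfl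

theorem primrec_gameCount : Primrec fun q : OTM × List ((Fin n → A) ⊕ (Fin n → E)) ×
    (Fin n → E) × ℕ => gameCount q.1 q.2.1 q.2.2.1 q.2.2.2 := by
  have h1 : Primrec fun z : (Fin n → A) ⊕ (Fin n → E) => sym z := .dom_finite _
  have h2 : Primrec fun e : Fin n → E => sym (Sum.inr e : (Fin n → A) ⊕ (Fin n → E)) :=
    .dom_finite _
  have h3 : Primrec fun q : OTM × List ((Fin n → A) ⊕ (Fin n → E)) × (Fin n → E) × ℕ =>
      q.2.1.map sym := list_map (Primrec.fst.comp .snd) (h1.comp .snd).to₂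
  exact OTM.Sim.primrec_count.comp (Primrec.fst.pair (h3.pair
    ((h2.comp (Primrec.fst.comp (Primrec.snd.comp .snd))).pair
      (Primrec.snd.comp (Primrec.snd.comp .snd)))))

end Approx

section Approx

open Filter Topology Primrec

variable {n : ℕ} {A E : Type*} [Fintype A] [Fintype E] [Primcodable A] [Primcodable E]
  {α : Type*} [Primcodable α]

attribute [local irreducible] gameCount stratCount distApprox

theorem primrec_actApprox {B : Type*} [Primcodable B] :
    Primrec fun q : Context n × List ((Fin n → A) × (Fin n → B)) ×
    (Fin n → A) => actApprox q.1 q.2.1 q.2.2 := by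
  refine primrec_finset_prod (fun j => Primrec.ite ?_ (.const 1) ?_) _
  · exact Primrec.eq.comp (Primrec.snd.comp (Primrec.fst.comp .fst)) (.const _)
  · have hs : Primrec fun q : Context n × List ((Fin n → A) × (Fin n → B)) × (Fin n → A) =>
        q.1.2.2 := Primrec.snd.comp (Primrec.snd.comp .fst)
    have hlo : Primrec₂ fun (q : Context n × List ((Fin n → A) × (Fin n → B)) × (Fin n → A))
        (a : A) => stratCount (q.1.1.1.2 j) (flat (proj j q.2.1)) a q.1.2.2 := by
      have hTj : Primrec fun q : Context n × List ((Fin n → A) × (Fin n → B)) × (Fin n → A) =>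
          q.1.1.1.2 j := fin_app.comp (Primrec.snd.comp (Primrec.fst.comp
            (Primrec.fst.comp .fst))) (.const j)
      have hp : Primrec fun q : Context n × List ((Fin n → A) × (Fin n → B)) × (Fin n → A) =>
          flat (proj j q.2.1) :=
        primrec_flat.comp (primrec_proj.comp (.const j) (Primrec.fst.comp .snd))
      have hg := (hTj.comp Primrec.fst).pair ((hp.comp .fst).pair
        ((Primrec.snd (β := A)).pair (hs.comp .fst)))
      exact ((primrec_stratCount (X := A) (Y := B)).comp hg).of_eq fun _ => rfl
    have ha : Primrec fun q : Context n × List ((Fin n → A) × (Fin n → B)) × (Fin n → A) =>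
        q.2.2 j := fin_app.comp (Primrec.snd.comp .snd) (.const j)
    have h := primrec_distApprox hlo (Primrec.fst.comp hs)
      (Primrec.fst.comp (Primrec.snd.comp .fst)) ha
    exact h.of_eq fun _ => rfl

theorem primrec_perApprox : Primrec fun q : Context n × List ((Fin n → A) × (Fin n → E)) ×
    (Fin n → A) × (Fin n → E) => perApprox q.1 q.2.1 q.2.2.1 q.2.2.2 := by
  have hK : Primrec fun q : Context n × List ((Fin n → A) × (Fin n → E)) × (Fin n → A) ×
      (Fin n → E) => q.1.2.2.1 := Primrec.fst.comp (Primrec.snd.comp (Primrec.snd.comp .fst))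
  have hlo : Primrec₂ fun (q : Context n × List ((Fin n → A) × (Fin n → E)) × (Fin n → A) ×
      (Fin n → E)) (e : Fin n → E) =>
        gameCount q.1.1.1.1 (flat q.2.1 ++ [.inl q.2.2.1]) e q.1.2.2.1 := by
    have hT : Primrec fun q : Context n × List ((Fin n → A) × (Fin n → E)) × (Fin n → A) ×
        (Fin n → E) => q.1.1.1.1 := Primrec.fst.comp (Primrec.fst.comp (Primrec.fst.comp .fst))
    have hx : Primrec fun q : Context n × List ((Fin n → A) × (Fin n → E)) × (Fin n → A) ×
        (Fin n → E) => flat q.2.1 ++ [.inl q.2.2.1] :=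
      list_append.comp (primrec_flat.comp (Primrec.fst.comp .snd)) (list_cons.comp (sumInl.comp
        (Primrec.fst.comp (Primrec.snd.comp .snd))) (.const []))
    have hg := (hT.comp Primrec.fst).pair ((hx.comp .fst).pair
      ((Primrec.snd (β := Fin n → E)).pair (hK.comp .fst)))
    exact (primrec_gameCount.comp hg).of_eq fun _ => rfl
  have h := primrec_distApprox hlo hK (Primrec.fst.comp (Primrec.snd.comp .fst))
    (Primrec.snd.comp (Primrec.snd.comp .snd))
  exact h.of_eq fun _ => rfl

theorem primrec_histWeight {X Y : Type*} [Primcodable X] [Primcodable Y]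
    {act : α → List (X × Y) → X → ℕ × ℕ} {per : α → List (X × Y) → X → Y → ℕ × ℕ}
    (ha : Primrec fun q : α × List (X × Y) × X => act q.1 q.2.1 q.2.2)
    (hp : Primrec fun q : α × List (X × Y) × X × Y => per q.1 q.2.1 q.2.2.1 q.2.2.2) :
    Primrec₂ fun c (x : Hist X Y) => histWeight (act c) (per c) x := by
  have hf : Primrec fun q : α × Hist X Y => (q.2.1.foldl (fun s z => (s.1 ++ [z],
      s.2 * act q.1 s.1 z.1 * per q.1 s.1 z.1 z.2)) (([] : List (X × Y)), ((1 : ℕ × ℕ)))) := by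
    refine list_foldl (h := fun q (p : (List (X × Y) × ℕ × ℕ) × X × Y) => (p.1.1 ++ [p.2],
      p.1.2 * act q.1 p.1.1 p.2.1 * per q.1 p.1.1 p.2.1 p.2.2))
      (f := fun q : α × Hist X Y => q.2.1) (Primrec.fst.comp .snd) (.const ([], 1)) ?_
    have hs : Primrec fun r : (α × Hist X Y) × (List (X × Y) × ℕ × ℕ) × X × Y => r.2.1 :=
      Primrec.fst.comp .snd
    have hz : Primrec fun r : (α × Hist X Y) × (List (X × Y) × ℕ × ℕ) × X × Y => r.2.2 :=
      Primrec.snd.comp .snd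
    have hc : Primrec fun r : (α × Hist X Y) × (List (X × Y) × ℕ × ℕ) × X × Y => r.1.1 :=
      Primrec.fst.comp .fst
    refine (list_concat.comp (Primrec.fst.comp hs) hz).pair (primrec_frac_mul.comp
      (primrec_frac_mul.comp (Primrec.snd.comp hs) ?_) ?_)
    · exact ha.comp (hc.pair ((Primrec.fst.comp hs).pair (Primrec.fst.comp hz)))
    · exact hp.comp (hc.pair ((Primrec.fst.comp hs).pair hz))
  refine primrec_frac_mul.comp (Primrec.snd.comp hf) ?_
  refine (option_casesOn (o := fun q : α × Hist X Y => q.2.2) (f := fun _ => 1)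
    (g := fun q a => act q.1 q.2.1 a) (Primrec.snd.comp .snd) (.const 1) ?_).of_eq fun q => ?_
  · exact ha.comp ((Primrec.fst.comp .fst).pair ((Primrec.fst.comp (Primrec.snd.comp .fst)).pair .snd))
  · cases q.2.2 <;> rfl

theorem primrec_fracSum : Primrec fracSum := by
  refine list_foldr .id (.const (0, 1)) (h := fun _ (p : (ℕ × ℕ) × (ℕ × ℕ)) =>
    (p.1.1 * p.2.2 + p.2.1 * p.1.2, p.1.2 * p.2.2)) ?_
  have hq : Primrec fun r : List (ℕ × ℕ) × (ℕ × ℕ) × (ℕ × ℕ) => r.2.1 := Primrec.fst.comp .snd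
  have hs : Primrec fun r : List (ℕ × ℕ) × (ℕ × ℕ) × (ℕ × ℕ) => r.2.2 := Primrec.snd.comp .snd
  exact (nat_add.comp (nat_mul.comp (Primrec.fst.comp hq) (Primrec.snd.comp hs))
    (nat_mul.comp (Primrec.fst.comp hs) (Primrec.snd.comp hq))).pair
    (nat_mul.comp (Primrec.snd.comp hq) (Primrec.snd.comp hs))

theorem primrec_sumApprox : Primrec₂ (@sumApprox n A E _ _ _ _) :=
  primrec_fracSum.comp (list_map .snd ((primrec_histWeight primrec_actApprox
    primrec_perApprox).comp (Primrec.fst.comp .fst) .snd))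

theorem primrec_quotApprox {nl nh dl dh : α → ℕ × ℕ} {k : α → ℕ} (hnl : Primrec nl)
    (hnh : Primrec nh) (hdl : Primrec dl) (hdh : Primrec dh) (hk : Primrec k) :
    Primrec fun x => quotApprox (nl x) (nh x) (dl x) (dh x) (k x) := by
  have hl1 := nat_mul.comp (Primrec.fst.comp hnl) (Primrec.snd.comp hdh)
  have hl2 := nat_mul.comp (Primrec.snd.comp hnl) (Primrec.fst.comp hdh)
  have hu1 := nat_mul.comp (Primrec.fst.comp hnh) (Primrec.snd.comp hdl)
  have hu2 := nat_mul.comp (Primrec.snd.comp hnh) (Primrec.fst.comp hdl)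
  refine Primrec.ite (((Primrec.eq.comp hl2 (.const 0)).not).and
    (((Primrec.eq.comp hu2 (.const 0)).not).and ?_)) (option_some.comp (hl1.pair hl2)) (.const none)
  exact nat_lt.comp (nat_mul.comp (nat_mul.comp hk hu1) hl2)
    (nat_add.comp (nat_mul.comp (nat_mul.comp hk hl1) hu2) (nat_mul.comp hu2 hl2))

/-! ### The estimating machine -/

/-- Quotients of sums of (partial) probabilities of histories can be estimated. -/
theorem exists_estimator (n : ℕ) (A E : Type*) [Fintype A] [Fintype E] [Primcodable A]
    [Primcodable E] {P X : Type*} [Primcodable P] [Primcodable X]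
    {conv : P → OTM × (Fin n → OTM)} {skip : P → Option (Fin n)}
    {num den : P × X → List (Hist (Fin n → A) (Fin n → E))}
    (hconv : Primrec conv) (hskip : Primrec skip) (hnum : Primrec num) (hden : Primrec den) :
    ∃ mk : P → OTM, Computable mk ∧ ∀ O : Oracle A E, O.Reflective →
      ∀ (σ : Game n A E) (π : Fin n → Strategy A E) (Tσ : OTM) (T : Fin n → OTM),
        Tσ.GeneratesGame σ → (∀ j, (T j).GeneratesStrategy O (π j)) →
        ∀ p, conv p = (Tσ, T) → ∀ (f : X → ℝ) (D : Set X),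
          (∀ x ∈ D, 0 < ((den (p, x)).map (partialDist σ π (skip p))).sum ∧
            f x = ((num (p, x)).map (partialDist σ π (skip p))).sum /
              ((den (p, x)).map (partialDist σ π (skip p))).sum) →
          (mk p).Estimates O.ans f D := by
  -- The precision is read off from the number of answers by unpairing, so each precision recurs
  -- with arbitrarily many answers.
  let ctx : P → Bool → List Bool → Context n := fun p b bs =>
    ((conv p, skip p), b, (Nat.unpair bs.length).1, bs)
  let dec : P × (X × ℕ) × List Bool → Option (ℕ × ℕ) := fun q =>
    quotApprox (sumApprox (ctx q.1 false q.2.2) (num (q.1, q.2.1.1)))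
      (sumApprox (ctx q.1 true q.2.2) (num (q.1, q.2.1.1)))
      (sumApprox (ctx q.1 false q.2.2) (den (q.1, q.2.1.1)))
      (sumApprox (ctx q.1 true q.2.2) (den (q.1, q.2.1.1))) q.2.1.2
  have hdec : Primrec dec := by
    have hctx : ∀ b, Primrec fun q : P × (X × ℕ) × List Bool => ctx q.1 b q.2.2 := fun b =>
      ((hconv.comp .fst).pair (hskip.comp .fst)).pair ((Primrec.const b).pair
        ((Primrec.fst.comp (Primrec.unpair.comp (list_length.comp (Primrec.snd.comp .snd)))).pair
          (Primrec.snd.comp .snd)))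
    have hx : Primrec fun q : P × (X × ℕ) × List Bool => (q.1, q.2.1.1) :=
      Primrec.fst.pair (Primrec.fst.comp (Primrec.fst.comp .snd))
    exact primrec_quotApprox (primrec_sumApprox.comp (hctx _) (hnum.comp hx))
      (primrec_sumApprox.comp (hctx _) (hnum.comp hx))
      (primrec_sumApprox.comp (hctx _) (hden.comp hx))
      (primrec_sumApprox.comp (hctx _) (hden.comp hx)) (Primrec.snd.comp (Primrec.fst.comp .snd))
  obtain ⟨mk, hmk, H⟩ := exists_collecting_machine hdec
  refine ⟨mk, hmk, fun O hO σ π Tσ T hσ hT p hp f D hD x hx k hk => ?_⟩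
  obtain ⟨h0, hfx⟩ := hD x hx
  have hN := brackets_sumApprox hO hσ hT (skip p) (num (p, x))
  have hD := brackets_sumApprox hO hσ hT (skip p) (den (p, x))
  rw [← hp] at hN hD
  have key := H O.ans p (x, k) {r | r.2 ≠ 0 ∧ |f x - (r.1 : ℝ) / r.2| < 1 / k} ?_ ?_
  · refine Eq.trans ?_ key
    congr 1
    ext w
    constructor
    · rintro ⟨a, b, hb, hw, hab⟩
      exact ⟨(a, b), ⟨hb, hab⟩, hw⟩
    · rintro ⟨r, ⟨hb, hab⟩, hw⟩
      exact ⟨r.1, r.2, hb, hw, hab⟩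
  · intro bs hbs r hr
    rw [Set.mem_ofPred_eq, hfx]
    exact quotApprox_spec hk hr (hN.lower (_, bs) hbs) (hN.upper (_, bs) hbs)
      (hD.lower (_, bs) hbs) (hD.upper (_, bs) hbs) h0 (sumApprox_spec _ _).1
  -- The upper and the lower quotient have the same limit because the denominator is positive, so
  -- their gap eventually drops below `1 / k`.
  · have hlim := ((hN.tendsto true).div (hD.tendsto false) h0.ne').sub
      ((hN.tendsto false).div (hD.tendsto true) h0.ne')
    rw [sub_self] at hlim
    have hk' : (0 : ℝ) < 1 / k := by positivity
    have hev := (hlim.eventually (gt_mem_nhds hk')).and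
      (((hD.tendsto false).eventually (lt_mem_nhds h0)).and
        ((hD.tendsto true).eventually (lt_mem_nhds h0)))
    obtain ⟨K, hK⟩ := eventually_answerFilter.1 hev
    obtain ⟨N, hN⟩ := hK K le_rfl
    -- With this many answers the precision is `K`, and there are at least the `N` answers that it
    -- needs.
    refine ⟨Nat.pair K N, fun bs hbs hlen => ?_⟩
    obtain ⟨h1, h2, h3⟩ := hN bs hbs (hlen ▸ Nat.right_le_pair K N)
    have hbK : ∀ b, ctx p b bs = ((conv p, skip p), b, K, bs) := fun b => by
      simp [ctx, hlen]
    simp only [dec, hbK]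
    refine quotApprox_isSome hk (sumApprox_spec _ _).1 (sumApprox_spec _ _).1 h2 h3 ?_
    simp only [Pi.div_apply] at h1
    linarith

end Approx

/-! ## Marginal distributions as sums over lists of histories -/

section Fiber

variable {Z : Type*} [Fintype Z]

/-- All lists of a given length. -/
noncomputable def allLists (Z : Type*) [Fintype Z] (t : ℕ) : List (List Z) :=
  (fun L => Finset.univ.toList.flatMap fun z => L.map (z :: ·))^[t] [[]]

theorem sum_map_flatMap {X Y : Type*} (l : List X) (f : X → List Y) (F : Y → ℝ) :
    ((l.flatMap f).map F).sum = (l.map fun x => ((f x).map F).sum).sum := by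
  induction l with
  | nil => simp
  | cons x l ih => simp [ih]

open Classical in
theorem sum_map_filter {X : Type*} (l : List X) (p : X → Prop) [DecidablePred p] (F : X → ℝ) :
    ((l.filter p).map F).sum = (l.map fun x => if p x then F x else 0).sum := by
  induction l with
  | nil => simp
  | cons x l ih =>
    rw [List.filter_cons, List.map_cons, List.sum_cons, ← ih]
    by_cases h : p x <;> simp [h]

theorem sum_map_allLists (t : ℕ) (F : List Z → ℝ) :
    ((allLists Z t).map F).sum = ∑ g : Fin t → Z, F (List.ofFn g) := by
  induction t generalizing F with
  | zero => simp [allLists]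
  | succ t ih =>
    rw [allLists, Function.iterate_succ_apply', ← allLists, sum_map_flatMap, Finset.sum_map_toList,
      ← (Fin.consEquiv fun _ : Fin (t + 1) => Z).sum_comp, Fintype.sum_prod_type]
    refine Finset.sum_congr rfl fun z _ => ?_
    rw [List.map_map, ih]
    exact Finset.sum_congr rfl fun g _ => by simp [Fin.consEquiv, List.ofFn_succ]

variable {n : ℕ} {A E : Type*} [Fintype A] [Fintype E]

/-- A joint history from the point of view of player `i`. -/
def projHist (i : Fin n) (x : Hist (Fin n → A) (Fin n → E)) : Hist A E :=
  (proj i x.1, x.2.map fun a => a i)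

open Classical in
/-- The joint histories whose `i`-th part is `y`. -/
noncomputable def fiber (i : Fin n) (y : Hist A E) : List (Hist (Fin n → A) (Fin n → E)) :=
  ((allLists _ y.1.length).filter fun g => proj i g = y.1).flatMap fun g =>
    y.2.elim [(g, none)] fun a => (Finset.univ.toList.filter fun b : Fin n → A => b i = a).map
      fun b => (g, some b)

theorem projHist_of_mem_fiber {i : Fin n} {y : Hist A E} {x : Hist (Fin n → A) (Fin n → E)}
    (hx : x ∈ fiber i y) : projHist i x = y := by
  obtain ⟨h, _ | a⟩ := y
  · simp only [fiber, List.mem_flatMap, List.mem_filter, decide_eq_true_eq, Option.elim_none,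
      List.mem_singleton] at hx
    obtain ⟨g, ⟨-, hg⟩, rfl⟩ := hx
    simp [projHist, hg]
  · simp only [fiber, List.mem_flatMap, List.mem_filter, decide_eq_true_eq, Option.elim_some,
      List.mem_map] at hx
    obtain ⟨g, ⟨-, hg⟩, b, ⟨-, hb⟩, rfl⟩ := hx
    simp [projHist, hg, hb]

/-- Turns the marginal into a sum over an explicit list, which a machine can enumerate. -/
theorem sum_map_fiber (σ : Game n A E) (π : Fin n → Strategy A E) (i : Fin n) (y : Hist A E) :
    ((fiber i y).map (histDist σ π)).sum = marginal σ π i y := by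
  classical
  obtain ⟨h, _ | a⟩ := y
  · rw [fiber, sum_map_flatMap, sum_map_filter, sum_map_allLists, marginal]
    exact Finset.sum_congr rfl fun g _ => by simp
  · rw [fiber, sum_map_flatMap, sum_map_filter, sum_map_allLists, marginal]
    refine Finset.sum_congr rfl fun g _ => ?_
    simp only [Option.elim_some, List.map_map, sum_map_filter, Finset.sum_map_toList]
    by_cases hg : proj i (List.ofFn g) = h <;> simp [hg]

/-- Player `i`'s factors see only player `i`'s part of the history, so they form a weight of the
projected history; everything else does not involve `ρ`. -/
theorem histDist_update (σ : Game n A E) (π : Fin n → Strategy A E) (i : Fin n)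
    (ρ : Strategy A E) (x : Hist (Fin n → A) (Fin n → E)) :
    histDist σ (Function.update π i ρ) x =
      histWeight (fun h a => (ρ h a : ℝ)) (fun _ _ _ => 1) (projHist i x) *
        partialDist σ π (some i) x := by
  unfold partialDist
  have hp : ∀ (h : List ((Fin n → A) × (Fin n → E))) a e,
      projHist i (h ++ [(a, e)], none) = (proj i h ++ [(a i, e i)], none) := fun h a e => by
    simp [projHist, proj]
  induction x using Hist.induction with
  | nil =>
    rw [histWeight_nil, histDist_nil, mul_one]
    exact (histWeight_nil _ _).symm
  | act h a ih =>
    have hact : actProb (Function.update π i ρ) h a = ρ (proj i h) (a i) *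
        ∏ j, if some i = some j then 1 else (π j (proj j h) (a j) : ℝ) := by
      rw [actProb, ← Finset.mul_prod_erase _ _ (Finset.mem_univ i),
        ← Finset.mul_prod_erase (a := i) _ (fun j => if some i = some j then (1 : ℝ) else _)
          (Finset.mem_univ i)]
      simp only [Function.update_self, if_true, one_mul]
      congr 1
      refine Finset.prod_congr rfl fun j hj => ?_
      have hj' := Finset.ne_of_mem_erase hj
      rw [Function.update_of_ne hj', if_neg (by simpa using hj'.symm)]
    have e1 : projHist i (h, some a) = (proj i h, some (a i)) := rfl
    have e2 : projHist i (h, none) = (proj i h, none) := rfl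
    rw [histDist_action, ih, histWeight_action, hact, e1, e2, histWeight_action]
    ring
  | per h a e ih =>
    have e1 : projHist i (h, some a) = (proj i h, some (a i)) := rfl
    rw [histDist_percept, ih, histWeight_percept, hp, histWeight_percept, e1]
    ring

/-- All histories in the fiber project to `y`, so the weight of `ρ` is a common factor of the sum.
-/
theorem marginal_update (σ : Game n A E) (π : Fin n → Strategy A E) (i : Fin n)
    (ρ : Strategy A E) (y : Hist A E) :
    marginal σ (Function.update π i ρ) i y =
      histWeight (fun h a => (ρ h a : ℝ)) (fun _ _ _ => 1) y *
        ((fiber i y).map (partialDist σ π (some i))).sum := by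
  rw [← sum_map_fiber, ← List.sum_map_mul_left]
  congr 1
  refine List.map_congr_left fun x hx => ?_
  rw [histDist_update, projHist_of_mem_fiber hx]

theorem histWeight_nonneg_of_strategy {B : Type*} (ρ : Strategy A B) (y : Hist A B) :
    0 ≤ histWeight (fun h a => (ρ h a : ℝ)) (fun _ _ _ => 1) y :=
  histWeight_closed (p := fun r : ℝ => 0 ≤ r) zero_le_one (fun _ _ => mul_nonneg)
    (fun h a => (ρ h).2.1 a) (fun _ _ _ => zero_le_one) y

/-! ### Primitive recursiveness -/

open Primrec

variable [Primcodable A] [Primcodable E]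

theorem primrec_allLists {Z : Type*} [Fintype Z] [Primcodable Z] : Primrec (allLists Z) :=
  nat_iterate .id (.const [[]]) (list_flatMap (.const _)
    (list_map (Primrec.snd.comp .fst) (list_cons.comp (Primrec.snd.comp .fst) .snd)))

theorem primrec_fiber : Primrec₂ (@fiber n A E _ _) := by
  classical
  have hl : Primrec fun q : Fin n × Hist A E =>
      allLists ((Fin n → A) × (Fin n → E)) q.2.1.length :=
    primrec_allLists.comp (list_length.comp (Primrec.fst.comp .snd))
  have hp : PrimrecRel fun (g : List ((Fin n → A) × (Fin n → E))) (q : Fin n × Hist A E) =>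
      proj q.1 g = q.2.1 :=
    Primrec.eq.comp (primrec_proj.comp (Primrec.fst.comp .snd) .fst)
      (Primrec.fst.comp (Primrec.snd.comp .snd))
  have hb : PrimrecRel fun (b : Fin n → A) (q : Fin n × A) => b q.1 = q.2 :=
    Primrec.eq.comp (fin_app.comp .fst (Primrec.fst.comp .snd)) (Primrec.snd.comp .snd)
  refine list_flatMap (hp.listFilter.comp hl .id) ?_
  refine (option_casesOn (o := fun r : (Fin n × Hist A E) × List ((Fin n → A) × (Fin n → E)) =>
    r.1.2.2) (f := fun r => [(r.2, none)])
    (g := fun r a => (Finset.univ.toList.filter fun b : Fin n → A => b r.1.1 = a).map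
      fun b => (r.2, some b))
    (Primrec.snd.comp (Primrec.snd.comp .fst))
    (list_cons.comp (Primrec.snd.pair (.const none)) (.const []))
    (list_map ?_ ?_)).of_eq fun r => ?_
  · have hi : Primrec fun q : ((Fin n × Hist A E) × List ((Fin n → A) × (Fin n → E))) × A =>
        (q.1.1.1, q.2) := (Primrec.fst.comp (Primrec.fst.comp .fst)).pair .snd
    exact hb.listFilter.comp (.const _) hi
  · exact (Primrec.snd.comp (Primrec.fst.comp .fst)).pair (option_some.comp .snd)
  · rcases h : r.1.2.2 with _ | a <;> simp [h]

theorem primrec_pred {X Y : Type*} [Primcodable X] [Primcodable Y] :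
    Primrec (@Hist.pred X Y) := by
  -- Access to the end of the list is expressed through reversal.
  have h : Primrec fun y : Hist X Y => (y.1.reverse.tail.reverse, y.1.reverse.head?.map Prod.fst) :=
    (list_reverse.comp (list_tail.comp (list_reverse.comp .fst))).pair
      (option_map (list_head?.comp (list_reverse.comp .fst)) (Primrec.fst.comp .snd))
  refine (option_casesOn (o := fun y : Hist X Y => y.2) (g := fun y _ => (y.1, none))
    .snd h ((Primrec.fst.comp .fst).pair (.const none))).of_eq fun y => ?_
  rcases y with ⟨h, _ | a⟩
  · simp [Hist.pred]
  · rfl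

end Fiber

/-! ### The theorem -/

theorem mainTheorem8 (n : ℕ) (A E : Type*) [Fintype A] [Fintype E] [Primcodable A]
    [Primcodable E] :
    ∃ (joint jointCond : OTM × (Fin n → OTM) → OTM)
      (marg margCond env : OTM × (Fin n → OTM) × Fin n → OTM),
      Computable joint ∧ Computable jointCond ∧
      Computable marg ∧ Computable margCond ∧ Computable env ∧
      ∀ O : Oracle A E, O.Reflective →
      ∀ (σ : Game n A E) (π : Fin n → Strategy A E) (Tσ : OTM) (T : Fin n → OTM),
        Tσ.GeneratesGame σ → (∀ j, (T j).GeneratesStrategy O (π j)) →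
        (joint (Tσ, T)).Estimates O.ans (histDist σ π) Set.univ ∧
        (jointCond (Tσ, T)).Estimates O.ans (condLast (histDist σ π))
          {y | 0 < histDist σ π y.pred} ∧
        ∀ i : Fin n,
          (marg (Tσ, T, i)).Estimates O.ans (marginal σ π i) Set.univ ∧
          (margCond (Tσ, T, i)).Estimates O.ans (condLast (marginal σ π i))
            {y | 0 < marginal σ π i y.pred} ∧
          ∀ ρ : Strategy A E,
            (env (Tσ, T, i)).Estimates O.ans (subjEnv σ (Function.update π i ρ) i)
              {x | 0 < marginal σ (Function.update π i ρ) i (x.1, some x.2.1)} := by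
  have one : ∀ {α : Type _} [Primcodable α] {f : α → Hist (Fin n → A) (Fin n → E)}, Primrec f →
      Primrec fun x => [f x] := fun hf => Primrec.list_cons.comp hf (.const [])
  have hconv : Primrec fun p : OTM × (Fin n → OTM) × Fin n => (p.1, p.2.1) :=
    Primrec.fst.pair (Primrec.fst.comp .snd)
  have hi : ∀ {X : Type _} [Primcodable X],
      Primrec fun q : (OTM × (Fin n → OTM) × Fin n) × X => q.1.2.2 :=
    Primrec.snd.comp (Primrec.snd.comp .fst)
  -- An unconditional probability is a quotient whose denominator is the empty history, of
  -- probability `1`.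
  obtain ⟨joint, hj, Hj⟩ := exists_estimator n A E (P := OTM × (Fin n → OTM))
    (X := Hist (Fin n → A) (Fin n → E)) (conv := fun p => p) (skip := fun _ => none)
    (num := fun q => [q.2]) (den := fun _ => [([], none)]) .id (.const _) (one .snd) (.const _)
  obtain ⟨jointCond, hjc, Hjc⟩ := exists_estimator n A E (P := OTM × (Fin n → OTM))
    (X := Hist (Fin n → A) (Fin n → E)) (conv := fun p => p) (skip := fun _ => none)
    (num := fun q => [q.2]) (den := fun q => [q.2.pred]) .id (.const _) (one .snd)
    (one (primrec_pred.comp .snd))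
  obtain ⟨marg, hm, Hm⟩ := exists_estimator n A E (P := OTM × (Fin n → OTM) × Fin n)
    (X := Hist A E) (conv := fun p => (p.1, p.2.1)) (skip := fun _ => none)
    (num := fun q => fiber q.1.2.2 q.2) (den := fun _ => [([], none)]) hconv (.const _)
    (primrec_fiber.comp hi .snd) (.const _)
  obtain ⟨margCond, hmc, Hmc⟩ := exists_estimator n A E (P := OTM × (Fin n → OTM) × Fin n)
    (X := Hist A E) (conv := fun p => (p.1, p.2.1)) (skip := fun _ => none)
    (num := fun q => fiber q.1.2.2 q.2) (den := fun q => fiber q.1.2.2 q.2.pred) hconv (.const _)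
    (primrec_fiber.comp hi .snd) (primrec_fiber.comp hi (primrec_pred.comp .snd))
  -- Player `i` is left out, so the estimated quotient does not involve `ρ`.
  obtain ⟨env, he, He⟩ := exists_estimator n A E (P := OTM × (Fin n → OTM) × Fin n)
    (X := List (A × E) × A × E) (conv := fun p => (p.1, p.2.1)) (skip := fun p => some p.2.2)
    (num := fun q => fiber q.1.2.2 (q.2.1 ++ [(q.2.2.1, q.2.2.2)], none))
    (den := fun q => fiber q.1.2.2 (q.2.1, some q.2.2.1)) hconv
    (Primrec.option_some.comp (Primrec.snd.comp .snd))
    (primrec_fiber.comp hi ((Primrec.list_concat.comp (Primrec.fst.comp .snd)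
      (Primrec.snd.comp .snd)).pair (.const none)))
    (primrec_fiber.comp hi ((Primrec.fst.comp .snd).pair
      (Primrec.option_some.comp (Primrec.fst.comp (Primrec.snd.comp .snd)))))
  refine ⟨joint, jointCond, marg, margCond, env, hj, hjc, hm, hmc, he,
    fun O hO σ π Tσ T hσ hT => ?_⟩
  have hnone : partialDist σ π none = histDist σ π := funext (partialDist_none σ π)
  have hnil : ([([], none)].map (histDist σ π)).sum = 1 := by simp [histDist_nil]
  refine ⟨Hj O hO σ π Tσ T hσ hT _ rfl _ _ fun x _ => ?_,
    Hjc O hO σ π Tσ T hσ hT _ rfl _ _ fun y hy => ?_, fun i =>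
    ⟨Hm O hO σ π Tσ T hσ hT _ rfl _ _ fun y _ => ?_,
    Hmc O hO σ π Tσ T hσ hT _ rfl _ _ fun y hy => ?_, fun ρ =>
    He O hO σ π Tσ T hσ hT _ rfl _ _ fun x hx => ?_⟩⟩
  · rw [hnone, hnil]
    exact ⟨one_pos, by simp⟩
  · rw [hnone]
    exact ⟨by simpa using hy, by simp [condLast]⟩
  · rw [hnone, hnil, sum_map_fiber]
    exact ⟨one_pos, by simp⟩
  · rw [hnone, sum_map_fiber, sum_map_fiber]
    exact ⟨hy, rfl⟩
  · have hx' : 0 < marginal σ (Function.update π i ρ) i (x.1, some x.2.1) := hx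
    -- The last percept contributes the factor `1`, so numerator and denominator carry the same
    -- weight of `ρ`.
    have hw := histWeight_percept (fun h a => (ρ h a : ℝ)) (fun _ _ (_ : E) => 1) x.1 x.2.1 x.2.2
    rw [mul_one] at hw
    rw [marginal_update] at hx'
    -- Positivity of the marginal under `ρ` makes the sum without player `i` positive, as the
    -- estimator requires.
    have hpos := pos_of_mul_pos_right hx' (histWeight_nonneg_of_strategy ρ _)
    refine ⟨hpos, ?_⟩
    rw [subjEnv, marginal_update, marginal_update, hw]
    exact mul_div_mul_left _ _ (left_ne_zero_of_mul hx'.ne')
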